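/- For integers $m,n,r\ge 0$ let $\mathbb{R}^{m\times n}_{\le r}=\{X\in\mathbb{R}^{m\times n}:\operatorname{rank}X\le r\}$. A matrix $X\in\mathbb{R}^{m\times n}_{\le r}$ is called first-order stationary for a differentiable $f:\mathbb{R}^{m\times n}\to\mathbb{R}$ if $\mathrm{D}f(X)[D]\ge 0$ for every $D$ in the tangent cone of $\mathbb{R}^{m\times n}_{\le r}$ at $X$, that is, for every limit $D=\lim_k (X_k-X)/\tau_k$ with $X_k\in\mathbb{R}^{m\times n}_{\le r}$, $X_k\to X$, $\tau_k>0$, $\tau_k\to0$. Let $\mathcal{M}=\mathbb{R}^{m\times r}\times\mathbb{R}^{n\times r}$ with its Euclidean structure and $\varphi(L,R)=LR^\top$. An SVD rebalancing is a map $\Phi:\mathcal{M}\to\mathcal{M}$ with $\Phi(L,R)=(U\Sigma^{1/2},V\Sigma^{1/2})$, where $U\Sigma V^\top$ is a singular value decomposition of $LR^\top$ with $\Sigma$ of size $r\times r$, chosen as a function of $LR^\top$. (Orthonormality of the columns of $U$ and $V$ is required only for the columns that belong to nonzero singular values. For $r\le\min(m,n)$ this gives the same maps $\Phi$ as the usual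 definition.) Consider the following algorithm, with parameters $\gamma_c,\eta\in(0,1)$ and $0<\underline\gamma\le\overline\gamma<\infty$ and with an SVD rebalancing $\Phi$ as a hook. Input: $f:\mathbb{R}^{m\times n}\to\mathbb{R}$ and $X_0\in\mathbb{R}^{m\times n}_{\le r}$. Put $g=f\circ\varphi$, pick any $y\in\mathcal{M}$ with $\varphi(y)=X_0$, set $y_0=\Phi(y)$ and pick $\gamma_0\in[\underline\gamma,\overline\gamma]$. For $k=0,1,2,\ldots$, let $m_k(s)=g(y_k)+\langle s,\nabla g(y_k)\rangle+\frac12\langle s,\nabla^2g(y_k)[s]\rangle$, let $\lambda_k$ be the least eigenvalue of $\nabla^2 g(y_k)$ (with $\lambda_k=0$ if $\mathcal{M}=\{0\}$) and let $(\lambda_k)_-=\min(\lambda_k,0)$. (i) If $\lambda_k<0$ and $\|\nabla g(y_k)\|^2<|(\lambda_k)_-|^3$, set $\delta_k=\gamma_k|(\lambda_k)_-|$ and let $u_k$ be a unit eigenvector of $\nabla^2g(y_k)$ for $\lambda_k$ with $\langle u_k,\nabla g(y_k)\rangle\le0$; otherwise set $\delta_k=\gamma_k\|\nabla g(y_k)\|$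 and $u_k=-\nabla g(y_k)$. (ii) Let $s_k^c=t_ku_k$, where $t_k$ minimizes $t\mapsto m_k(tu_k)$ over all $t\ge0$ with $\|tu_k\|\le\delta_k$. Take any $s_k\in\mathcal{M}$ with $\|s_k\|\le\delta_k$ and $m_k(s_k)\le m_k(s_k^c)$. (iii) Let $\rho_k=\dfrac{g(y_k)-g(y_k+s_k)}{m_k(0)-m_k(s_k)}$, or $\rho_k=1$ if the denominator is zero. If $\rho_k\ge\eta$, set $y_{k+1}=\Phi(y_k+s_k)$ and choose any $\gamma_{k+1}\in[\underline\gamma,\overline\gamma]$; otherwise set $y_{k+1}=y_k$ and $\gamma_{k+1}=\gamma_c\gamma_k$. The algorithm generates the matrices $X_k=\varphi(y_k)$. Theorem. For all $m,n,r$ and all parameters as above, an SVD rebalancing exists, and for every SVD rebalancing $\Phi$ and every three times continuously differentiable $f:\mathbb{R}^{m\times n}\to\mathbb{R}$ the algorithm has the following properties. (a) An iteration can be carried out from every $y_k\in\mathcal{M}$ and $\gamma_k>0$. (b) For every $X_0\in\mathbb{R}^{m\times n}_{\le r}$ for which $\{X\in\mathbb{R}^{m\times n}_{\le r}:f(X)\le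 f(X_0)\}$ is bounded, the algorithm generates an infinite sequence from $X_0$, and every sequence $(X_k)_{k\ge0}$ that it can generate from $X_0$ starts at $X_0$, lies in $\mathbb{R}^{m\times n}_{\le r}$, has $f(X_{k+1})\le f(X_k)$ for all $k$, and has at least one accumulation point; every accumulation point of $(X_k)$ is first-order stationary for $f$ on $\mathbb{R}^{m\times n}_{\le r}$. -/

import Mathlib

open Filter Topology
open scoped Matrix

attribute [local instance] Matrix.frobeniusNormedAddCommGroup Matrix.frobeniusNormedSpace

noncomputable section

/-! ### The bounded-rank variety and stationarity -/

/-- The matrices of size `m × n` and rank at most `r`. -/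
def boundedRank (m n r : ℕ) : Set (Matrix (Fin m) (Fin n) ℝ) :=
  {X | X.rank ≤ r}

/-- `X` is first-order stationary for the minimization of `f` over matrices of rank at most `r`:
it is feasible and the directional derivative of `f` at `X` is nonnegative along every direction of
the (Bouligand) tangent cone of the variety at `X`, that is, along every limit of
`(X_k - X) / τ_k` with feasible `X_k → X` and `τ_k → 0`, `τ_k > 0`. -/
def IsRankStationary {m n : ℕ} (r : ℕ) (f : Matrix (Fin m) (Fin n) ℝ → ℝ)
    (X : Matrix (Fin m) (Fin n) ℝ) : Prop :=
  X ∈ boundedRank m n r ∧ ∀ D ∈ posTangentConeAt (boundedRank m n r) X, 0 ≤ fderiv ℝ f X D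

/-! ### The trust-region method with a hook, on a Euclidean space

The retraction is `(y, s) ↦ y + s`, so that the pullback of `g` at `y` is `s ↦ g (y + s)`. -/

/-- Parameters of the method. -/
structure TRParams where
  /-- contraction factor after an unsuccessful step -/
  γc : ℝ
  /-- acceptance threshold -/
  η : ℝ
  /-- lower bound on the radius factor at the start and after a successful step -/
  γlo : ℝ
  /-- upper bound on the radius factor -/
  γup : ℝ
  γc_pos : 0 < γc
  γc_lt_one : γc < 1
  η_pos : 0 < η
  η_lt_one : η < 1
  γlo_pos : 0 < γlo
  γlo_le_γup : γlo ≤ γup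

instance : Inhabited TRParams :=
  ⟨⟨1 / 2, 1 / 2, 1, 1, by norm_num, by norm_num, by norm_num, by norm_num, by norm_num, le_rfl⟩⟩

section Method

variable {E : Type*} [NormedAddCommGroup E] [InnerProductSpace ℝ E] [CompleteSpace E]

/-- The Hessian of `g` at `y`, the derivative of the gradient. -/
def hess (g : E → ℝ) (y : E) : E →L[ℝ] E :=
  fderiv ℝ (gradient g) y

/-- The second-order Taylor model of `g` at `y`. -/
def trModel (g : E → ℝ) (y s : E) : ℝ :=
  g y + inner ℝ s (gradient g y) + 1 / 2 * inner ℝ s (hess g y s)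

/-- The least eigenvalue of the Hessian of `g` at `y` (and `0` if `E` is the zero space). -/
def lamMin (g : E → ℝ) (y : E) : ℝ :=
  sInf {μ : ℝ | Module.End.HasEigenvalue (hess g y : E →ₗ[ℝ] E) μ}

/-- The condition under which the radius is set by the negative curvature, not by the gradient. -/
def UsesCurvature (g : E → ℝ) (y : E) : Prop :=
  lamMin g y < 0 ∧ ‖gradient g y‖ ^ 2 < |min (lamMin g y) 0| ^ 3

open Classical in
/-- The trust-region radius. -/
def trRadius (g : E → ℝ) (y : E) (γ : ℝ) : ℝ :=
  if UsesCurvature g y then γ * |min (lamMin g y) 0| else γ * ‖gradient g y‖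

/-- `u` is a direction defining a Cauchy step: a unit eigenvector for the least eigenvalue of the
Hessian, pointing along a non-ascent direction, or the negative gradient. -/
def IsCauchyDirection (g : E → ℝ) (y u : E) : Prop :=
  (UsesCurvature g y →
    ‖u‖ = 1 ∧ hess g y u = lamMin g y • u ∧ inner ℝ u (gradient g y) ≤ 0) ∧
  (¬ UsesCurvature g y → u = -gradient g y)

/-- `sc` is a Cauchy step: it minimizes the model along the ray of a Cauchy direction, within the
trust region. -/
def IsCauchyStep (g : E → ℝ) (y : E) (γ : ℝ) (sc : E) : Prop :=
  ∃ (u : E) (t : ℝ), IsCauchyDirection g y u ∧ sc = t • u ∧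
    0 ≤ t ∧ ‖t • u‖ ≤ trRadius g y γ ∧
    ∀ t' : ℝ, 0 ≤ t' → ‖t' • u‖ ≤ trRadius g y γ → trModel g y (t • u) ≤ trModel g y (t' • u)

/-- `s` is an admissible trial step: it lies in the trust region and does at least as well as a
Cauchy step in terms of the model. -/
def IsTrialStep (g : E → ℝ) (y : E) (γ : ℝ) (s : E) : Prop :=
  ‖s‖ ≤ trRadius g y γ ∧ ∃ sc, IsCauchyStep g y γ sc ∧ trModel g y s ≤ trModel g y sc

open Classical in
/-- The ratio of actual to predicted decrease (`1` if the predicted decrease is zero). -/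
def trRatio (g : E → ℝ) (y s : E) : ℝ :=
  if trModel g y 0 - trModel g y s = 0 then 1
  else (g y - g (y + s)) / (trModel g y 0 - trModel g y s)

/-- One iteration of the method with hook `Φ` may go from `(y, γ)` to `(y', γ')`. -/
def TRStep (p : TRParams) (Φ : E → E) (g : E → ℝ) (y : E) (γ : ℝ) (y' : E) (γ' : ℝ) : Prop :=
  ∃ s, IsTrialStep g y γ s ∧
    ((p.η ≤ trRatio g y s ∧ y' = Φ (y + s) ∧ γ' ∈ Set.Icc p.γlo p.γup) ∨
      (trRatio g y s < p.η ∧ y' = y ∧ γ' = p.γc * γ))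

/-- `(y k, γ k)` is a sequence generated by the method with hook `Φ` on the cost function `g` from
the initial point `yin`. -/
def IsTRRun (p : TRParams) (Φ : E → E) (g : E → ℝ) (yin : E) (y : ℕ → E) (γ : ℕ → ℝ) : Prop :=
  y 0 = Φ yin ∧ γ 0 ∈ Set.Icc p.γlo p.γup ∧ ∀ k, TRStep p Φ g (y k) (γ k) (y (k + 1)) (γ (k + 1))

end Method

/-! ### The lift `(L, R) ↦ L Rᵀ` and its rebalancing -/

/-- The space of pairs `(L, R)` of matrices of sizes `m × r` and `n × r`, with its Euclidean
structure. -/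
abbrev FactorSpace (m n r : ℕ) : Type :=
  EuclideanSpace ℝ ((Fin m × Fin r) ⊕ (Fin n × Fin r))

/-- The factor `L` of `(L, R)`. -/
def leftFactor {m n r : ℕ} (y : FactorSpace m n r) : Matrix (Fin m) (Fin r) ℝ :=
  Matrix.of fun i a => y (Sum.inl (i, a))

/-- The factor `R` of `(L, R)`. -/
def rightFactor {m n r : ℕ} (y : FactorSpace m n r) : Matrix (Fin n) (Fin r) ℝ :=
  Matrix.of fun j a => y (Sum.inr (j, a))

/-- The lift `(L, R) ↦ L Rᵀ`. -/
def lrLift {m n r : ℕ} (y : FactorSpace m n r) : Matrix (Fin m) (Fin n) ℝ :=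
  leftFactor y * (rightFactor y)ᵀ

/-- `X = U Σ Vᵀ` is a singular value decomposition with `r` singular values (in any order).
Orthonormality is asked of the columns of nonzero singular values: for `r ≤ min m n` the other
columns, which do not affect `U Σ` and `V Σ`, can always be chosen so as to make all columns
orthonormal, and for larger `r` no choice does. -/
structure IsSVD {m n r : ℕ} (X : Matrix (Fin m) (Fin n) ℝ) (U : Matrix (Fin m) (Fin r) ℝ)
    (σ : Fin r → ℝ) (V : Matrix (Fin n) (Fin r) ℝ) : Prop where
  nonneg : ∀ a, 0 ≤ σ a
  left : ∀ a b, σ a ≠ 0 → σ b ≠ 0 → (Uᵀ * U) a b = if a = b then 1 else 0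
  right : ∀ a b, σ a ≠ 0 → σ b ≠ 0 → (Vᵀ * V) a b = if a = b then 1 else 0
  eq : X = U * Matrix.diagonal σ * Vᵀ

/-- `Φ (L, R) = (U Σ^{1/2}, V Σ^{1/2})`, where `U Σ Vᵀ` is a singular value decomposition of
`L Rᵀ`, chosen as a function of `L Rᵀ`. -/
structure IsSVDRebalancing {m n r : ℕ} (Φ : FactorSpace m n r → FactorSpace m n r) : Prop where
  svd : ∀ y, ∃ U σ V, IsSVD (lrLift y) U σ V ∧
    leftFactor (Φ y) = U * Matrix.diagonal (fun a => √(σ a)) ∧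
    rightFactor (Φ y) = V * Matrix.diagonal (fun a => √(σ a))
  sectional : ∀ y y', lrLift y = lrLift y' → Φ y = Φ y'

/-- `(y k, γ k)` is a sequence generated by the hooked trust-region method on `(L, R) ↦ f (L Rᵀ)`,
started at some factorization of `X₀`. -/
def IsLowRankRun {m n r : ℕ} (p : TRParams) (Φ : FactorSpace m n r → FactorSpace m n r)
    (f : Matrix (Fin m) (Fin n) ℝ → ℝ) (X₀ : Matrix (Fin m) (Fin n) ℝ)
    (y : ℕ → FactorSpace m n r) (γ : ℕ → ℝ) : Prop :=
  ∃ yin, lrLift yin = X₀ ∧ IsTRRun p Φ (fun z => f (lrLift z)) yin y γ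

end

/-! Put g = f ∘ φ. Two facts combine: accumulation points of the factors are second-order critical
for g, and balanced second-order critical points map to stationary matrices.

Criticality is measured by the continuous `secondOrderViolation`, whose exponents 2 and 3 match the
model decrease of gradient and curvature steps (`IsTrialStep.le_trModel_sub`). Where it is positive,
a step of relative radius γ has length O(γ) and model decrease of order γ² for small γ, while the
Taylor error is o(γ²) locally uniformly; small radii are therefore accepted. Hence the radius factor
cannot collapse near such a point, and a visit leads to a drop of g by a fixed amount, which is
impossible near an accumulation point of a descent sequence
(`IsTRRun.secondOrderViolation_eq_zero`).

The hook preserves φ, hence g, and makes iterates balanced. Balance bounds the factors by their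
product (`IsBalanced.norm_sq_le`), so a bounded sublevel set keeps them in a compact set; it is also
a closed condition, so it survives in the limit.

At a balanced critical point the common Gram matrix is diagonal. If it is nonsingular, Df vanishes
on the tangent space of the rank-r matrices, which controls the whole tangent cone by a Schur
complement identity. Otherwise L and R share a zero column, and moving both factors at speed √τ in
that column reaches every matrix unit at first order; nonnegative curvature of g then forces Df = 0.
-/

/-! ### Least eigenvalue of a symmetric operator. -/

section SymmetricOperator

variable {E : Type*} [NormedAddCommGroup E] [InnerProductSpace ℝ E] [FiniteDimensional ℝ E]

/-- The least eigenvalue of a symmetric operator is attained and bounds its quadratic form from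
below. -/
theorem LinearMap.IsSymmetric.sInf_eigenvalue_isLeast [Nontrivial E] {T : E →ₗ[ℝ] E}
    (hT : T.IsSymmetric) :
    IsLeast {μ : ℝ | Module.End.HasEigenvalue T μ}
        (sInf {μ : ℝ | Module.End.HasEigenvalue T μ}) ∧
      ∀ u, sInf {μ : ℝ | Module.End.HasEigenvalue T μ} * ‖u‖ ^ 2 ≤ inner ℝ u (T u) := by
  set q : E → ℝ := fun x => inner ℝ (T x) x / ‖x‖ ^ 2 with hq
  have hmem : Module.End.HasEigenvalue T (⨅ x : {x : E // x ≠ 0}, q x) := by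
    simpa [hq] using hT.hasEigenvalue_iInf_of_finiteDimensional
  -- A real infimum over a set unbounded below has a default value, so boundedness is needed for it
  -- to be a lower bound.
  have hbdd : BddBelow (Set.range fun x : {x : E // x ≠ 0} => q x) := by
    refine ⟨-‖LinearMap.toContinuousLinearMap T‖, ?_⟩
    rintro _ ⟨⟨x, hx⟩, rfl⟩
    have h := (LinearMap.toContinuousLinearMap T).rayleighQuotient_le_norm x
    simpa [hq, ContinuousLinearMap.rayleighQuotient, ContinuousLinearMap.reApplyInnerSelf] using
      (abs_le.mp h).1
  have hle : ∀ u : E, u ≠ 0 → (⨅ x : {x : E // x ≠ 0}, q x) ≤ q u := fun u hu =>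
    ciInf_le hbdd ⟨u, hu⟩
  have hleast : IsLeast {μ : ℝ | Module.End.HasEigenvalue T μ} (⨅ x : {x : E // x ≠ 0}, q x) := by
    refine ⟨hmem, fun μ hμ => ?_⟩
    obtain ⟨v, hv⟩ := Module.End.HasEigenvalue.exists_hasEigenvector hμ
    have h0 : ‖v‖ ^ 2 ≠ 0 := pow_ne_zero 2 (norm_ne_zero_iff.mpr hv.2)
    calc _ ≤ q v := hle v hv.2
      _ = μ := by
        simp only [hq, hv.apply_eq_smul, real_inner_smul_left, real_inner_self_eq_norm_sq]
        exact mul_div_cancel_right₀ μ h0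
  rw [hleast.csInf_eq]
  refine ⟨hleast, fun u => ?_⟩
  by_cases hu : u = 0
  · simp [hu]
  · have h0 : 0 < ‖u‖ ^ 2 := pow_pos (norm_pos_iff.mpr hu) 2
    have h := (le_div_iff₀ h0).mp (hle u hu)
    rwa [real_inner_comm] at h

end SymmetricOperator

/-! ### Gradient, Hessian and Taylor estimate. -/

section Smooth

variable {E : Type*} [NormedAddCommGroup E] [InnerProductSpace ℝ E] [CompleteSpace E]

theorem gradient_eq_toDual_symm_comp (g : E → ℝ) :
    gradient g = (InnerProductSpace.toDual ℝ E).symm.toContinuousLinearEquiv ∘ fderiv ℝ g := rfl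

variable {g : E → ℝ}

theorem contDiff_gradient (hg : ContDiff ℝ 2 g) : ContDiff ℝ 1 (gradient g) := by
  rw [gradient_eq_toDual_symm_comp]
  exact (ContinuousLinearEquiv.contDiff _).comp (hg.fderiv_right (by norm_num))

theorem continuous_gradient (hg : ContDiff ℝ 2 g) : Continuous (gradient g) :=
  (contDiff_gradient hg).continuous

theorem hasFDerivAt_gradient (hg : ContDiff ℝ 2 g) (y : E) :
    HasFDerivAt (gradient g) (hess g y) y :=
  ((contDiff_gradient hg).differentiable (by norm_num) y).hasFDerivAt

theorem continuous_hess (hg : ContDiff ℝ 2 g) : Continuous (hess g) :=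
  (contDiff_gradient hg).continuous_fderiv (by norm_num)

theorem inner_hess_eq_fderiv_fderiv (hg : ContDiff ℝ 2 g) (y u v : E) :
    inner ℝ (hess g y u) v = fderiv ℝ (fderiv ℝ g) y u v := by
  have h2 : HasFDerivAt (fderiv ℝ g) (fderiv ℝ (fderiv ℝ g) y) y :=
    ((hg.fderiv_right (m := 1) (by norm_num)).differentiable (by norm_num) y).hasFDerivAt
  have h := ((InnerProductSpace.toDual ℝ E).symm.toContinuousLinearEquiv.hasFDerivAt.comp y h2)
  rw [← gradient_eq_toDual_symm_comp] at h
  rw [hess, h.fderiv]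
  simp

theorem hess_isSymmetric (hg : ContDiff ℝ 2 g) (y : E) :
    (hess g y : E →ₗ[ℝ] E).IsSymmetric := by
  intro u v
  have h := (hg.contDiffAt (x := y)).isSymmSndFDerivAt (by simp)
  simp only [ContinuousLinearMap.coe_coe]
  rw [real_inner_comm (hess g y v), inner_hess_eq_fderiv_fderiv hg, inner_hess_eq_fderiv_fderiv hg]
  exact h u v

/-- Locally uniform second-order Taylor estimate. -/
theorem exists_ball_abs_sub_trModel_le (hg : ContDiff ℝ 2 g) (x : E) {ε : ℝ} (hε : 0 < ε) :
    ∃ δ > 0, ∀ y s : E, ‖y - x‖ < δ → ‖s‖ < δ → |g (y + s) - trModel g y s| ≤ ε * ‖s‖ ^ 2 := by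
  obtain ⟨d, hd, hcont⟩ := Metric.continuous_iff.mp (continuous_hess hg) x (ε / 2) (by positivity)
  refine ⟨d / 2, by positivity, fun y s hy hs => ?_⟩
  have hH : ∀ z ∈ Metric.ball (0 : E) (d / 2), ‖hess g (y + z) - hess g y‖ ≤ ε := by
    intro z hz
    rw [mem_ball_zero_iff] at hz
    have h1 := hcont (y + z) (by
      rw [dist_eq_norm]
      calc ‖y + z - x‖ = ‖(y - x) + z‖ := by congr 1; abel
        _ ≤ ‖y - x‖ + ‖z‖ := norm_add_le _ _
        _ < d := by linarith)
    have h2 := hcont y (by rw [dist_eq_norm]; linarith)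
    rw [dist_eq_norm] at h1 h2
    calc ‖hess g (y + z) - hess g y‖
        = ‖(hess g (y + z) - hess g x) - (hess g y - hess g x)‖ := by congr 1; abel
      _ ≤ _ := norm_sub_le _ _
      _ ≤ ε := by linarith
  have hgrad : ∀ z ∈ Metric.ball (0 : E) (d / 2),
      ‖gradient g (y + z) - gradient g y - hess g y z‖ ≤ ε * ‖z‖ := by
    intro z hz
    -- Mean value inequality: this map has derivative `hess g (y + w) - hess g y`, of norm at most ε
    -- on the ball.
    have h := (convex_ball (0 : E) (d / 2)).norm_image_sub_le_of_norm_hasFDerivWithin_le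
      (f := fun w => gradient g (y + w) - hess g y w) (x := 0) (y := z)
      (fun w hw => ((hasFDerivAt_comp_add_left y).mpr (hasFDerivAt_gradient hg (y + w)) |>.sub
        (hess g y).hasFDerivAt).hasFDerivWithinAt) hH (Metric.mem_ball_self (by positivity)) hz
    have e : gradient g (y + z) - gradient g y - hess g y z
        = gradient g (y + z) - hess g y z - (gradient g (y + 0) - hess g y 0) := by
      rw [add_zero, map_zero]; abel
    rw [e]
    simpa using h
  have hs' : s ∈ Metric.ball (0 : E) (d / 2) := by simpa using hs
  have hderiv : ∀ w : E, HasFDerivAt (fun w => g (y + w) - trModel g y w)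
      (InnerProductSpace.toDual ℝ E (gradient g (y + w) - gradient g y - hess g y w)) w := by
    intro w
    have h1 : HasFDerivAt (fun w => g (y + w)) (fderiv ℝ g (y + w)) w :=
      (hasFDerivAt_comp_add_left y).mpr (hg.differentiable (by norm_num) (y + w)).hasFDerivAt
    have h2 : HasFDerivAt (fun w : E => inner ℝ w (gradient g y))
        ((fderivInnerCLM ℝ (w, gradient g y)).comp
          ((ContinuousLinearMap.id ℝ E).prod (0 : E →L[ℝ] E))) w :=
      (hasFDerivAt_id w).inner ℝ (hasFDerivAt_const _ _)
    have h3 : HasFDerivAt (fun w : E => inner ℝ w (hess g y w))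
        ((fderivInnerCLM ℝ (w, hess g y w)).comp
          ((ContinuousLinearMap.id ℝ E).prod (hess g y))) w :=
      (hasFDerivAt_id w).inner ℝ (hess g y).hasFDerivAt
    have h := h1.sub ((h2.const_add (g y)).add (h3.const_mul (1 / 2)))
    refine h.congr_fderiv ?_
    ext v
    have hsym := hess_isSymmetric hg y w v
    simp only [ContinuousLinearMap.coe_coe] at hsym
    simp [hsym]
    rw [real_inner_comm (hess g y w) v, hsym]
    ring
  -- A second mean value inequality, on the ball of radius ‖s‖, integrates the gradient error to
  -- ε‖s‖².
  have h := (convex_closedBall (0 : E) ‖s‖).norm_image_sub_le_of_norm_hasFDerivWithin_le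
    (f := fun w => g (y + w) - trModel g y w) (x := 0) (y := s) (C := ε * ‖s‖)
    (fun w _ => (hderiv w).hasFDerivWithinAt)
    (fun w hw => by
      rw [LinearIsometryEquiv.norm_map]
      rw [mem_closedBall_zero_iff] at hw
      refine (hgrad w (by rw [mem_ball_zero_iff]; linarith)).trans ?_
      gcongr)
    (by simp) (by simp)
  have h0 : trModel g y 0 = g y := by simp [trModel]
  simp only [add_zero, h0, sub_self, sub_zero, Real.norm_eq_abs] at h
  linarith [h, sq ‖s‖, mul_assoc ε ‖s‖ ‖s‖]

end Smooth

noncomputable section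

/-! ### Continuity of the least Hessian eigenvalue. -/

section LeastEigenvalue

theorem lamMin_of_subsingleton {E : Type*} [NormedAddCommGroup E] [InnerProductSpace ℝ E]
    [CompleteSpace E] [Subsingleton E] (g : E → ℝ) (y : E) : lamMin g y = 0 := by
  have h : {μ : ℝ | Module.End.HasEigenvalue (hess g y : E →ₗ[ℝ] E) μ} = ∅ := by
    ext μ
    simp only [Set.mem_ofPred_eq, Set.mem_empty_iff_false, iff_false]
    intro hμ
    obtain ⟨v, hv⟩ := hμ.exists_hasEigenvector
    exact hv.2 (Subsingleton.elim _ _)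
  rw [lamMin, h, Real.sInf_empty]

variable {E : Type*} [NormedAddCommGroup E] [InnerProductSpace ℝ E] [FiniteDimensional ℝ E]
  {g : E → ℝ}

theorem lamMin_mul_norm_sq_le (hg : ContDiff ℝ 2 g) (y u : E) :
    lamMin g y * ‖u‖ ^ 2 ≤ inner ℝ u (hess g y u) := by
  rcases subsingleton_or_nontrivial E with h | h
  · simp [Subsingleton.elim u 0]
  · exact (hess_isSymmetric hg y).sInf_eigenvalue_isLeast.2 u

theorem exists_unit_eigenvector_lamMin [Nontrivial E] (hg : ContDiff ℝ 2 g) (y : E) :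
    ∃ u : E, ‖u‖ = 1 ∧ hess g y u = lamMin g y • u := by
  obtain ⟨v, hv⟩ := Module.End.HasEigenvalue.exists_hasEigenvector
    (hess_isSymmetric hg y).sInf_eigenvalue_isLeast.1.1
  have h0 : ‖v‖ ≠ 0 := norm_ne_zero_iff.mpr hv.2
  refine ⟨‖v‖⁻¹ • v, by simp [norm_smul, h0], ?_⟩
  have h := hv.apply_eq_smul
  simp only [ContinuousLinearMap.coe_coe] at h
  rw [map_smul, h, smul_comm]
  rfl

theorem abs_lamMin_le_norm_hess (hg : ContDiff ℝ 2 g) (y : E) : |lamMin g y| ≤ ‖hess g y‖ := by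
  rcases subsingleton_or_nontrivial E with h | h
  · simp [lamMin_of_subsingleton]
  · obtain ⟨u, hu, hHu⟩ := exists_unit_eigenvector_lamMin hg y
    simpa [hHu, norm_smul, hu] using (hess g y).le_opNorm u

/-- A unit eigenvector at `z` is a test vector for the quadratic form at `y`. By symmetry in `y` and
`z`, the least eigenvalue is 1-Lipschitz in the Hessian. -/
theorem lamMin_le_add_norm_sub (hg : ContDiff ℝ 2 g) (y z : E) :
    lamMin g y ≤ lamMin g z + ‖hess g y - hess g z‖ := by
  rcases subsingleton_or_nontrivial E with h | h
  · simp [lamMin_of_subsingleton]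
  · obtain ⟨u, hu, hHu⟩ := exists_unit_eigenvector_lamMin hg z
    have h1 := lamMin_mul_norm_sq_le hg y u
    have h2 : inner ℝ u (hess g z u) = lamMin g z := by
      simp [hHu, inner_smul_right, hu]
    have h3 : inner ℝ u ((hess g y - hess g z) u) ≤ ‖hess g y - hess g z‖ := by
      refine (real_inner_le_norm _ _).trans ?_
      simpa [hu] using (hess g y - hess g z).le_opNorm u
    rw [sub_apply, inner_sub_right, h2] at h3
    rw [hu] at h1
    linarith

theorem continuous_lamMin (hg : ContDiff ℝ 2 g) : Continuous (lamMin g) := by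
  rw [Metric.continuous_iff]
  intro x ε hε
  obtain ⟨δ, hδ, h⟩ := Metric.continuous_iff.mp (continuous_hess hg) x ε hε
  refine ⟨δ, hδ, fun y hy => ?_⟩
  have h1 := h y hy
  have h2 := lamMin_le_add_norm_sub hg y x
  have h3 := lamMin_le_add_norm_sub hg x y
  rw [norm_sub_rev] at h3
  rw [dist_eq_norm] at h1
  rw [Real.dist_eq, abs_lt]
  constructor <;> linarith

end LeastEigenvalue

/-! ### Trial steps and model decrease. -/

section Step

variable {E : Type*} [NormedAddCommGroup E] [InnerProductSpace ℝ E] [FiniteDimensional ℝ E]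
  {g : E → ℝ}

/-- A continuous measure of the violation of the second-order necessary conditions. -/
def secondOrderViolation (g : E → ℝ) (y : E) : ℝ :=
  max (‖gradient g y‖ ^ 2) (|min (lamMin g y) 0| ^ 3)

theorem continuous_secondOrderViolation (hg : ContDiff ℝ 2 g) :
    Continuous (secondOrderViolation g) :=
  ((continuous_gradient hg).norm.pow 2).max
    (((continuous_lamMin hg).min continuous_const).abs.pow 3)

theorem secondOrderViolation_nonneg (g : E → ℝ) (y : E) : 0 ≤ secondOrderViolation g y :=
  le_max_of_le_left (by positivity)

theorem critical_of_secondOrderViolation_eq_zero {y : E} (h : secondOrderViolation g y = 0) :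
    gradient g y = 0 ∧ 0 ≤ lamMin g y := by
  have h1 : ‖gradient g y‖ ^ 2 ≤ 0 := (le_max_left _ _).trans_eq h
  have h2 : |min (lamMin g y) 0| ^ 3 ≤ 0 := (le_max_right _ _).trans_eq h
  have h3 : ‖gradient g y‖ = 0 := by
    by_contra hne
    exact absurd h1 (not_le.mpr (by positivity))
  have h4 : |min (lamMin g y) 0| = 0 := by
    by_contra hne
    exact absurd h2 (not_le.mpr (by positivity))
  exact ⟨norm_eq_zero.mp h3, min_eq_right_iff.mp (abs_eq_zero.mp h4)⟩

theorem trModel_zero (g : E → ℝ) (y : E) : trModel g y 0 = g y := by simp [trModel]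

theorem trModel_smul (g : E → ℝ) (y u : E) (t : ℝ) :
    trModel g y (t • u) =
      g y + t * inner ℝ u (gradient g y) + 1 / 2 * t ^ 2 * inner ℝ u (hess g y u) := by
  simp only [trModel, map_smul, inner_smul_left, inner_smul_right, conj_trivial]
  ring

theorem continuous_trModel (g : E → ℝ) (y : E) : Continuous (trModel g y) := by
  unfold trModel
  fun_prop

theorem trRadius_nonneg (g : E → ℝ) (y : E) {γ : ℝ} (hγ : 0 ≤ γ) : 0 ≤ trRadius g y γ := by
  unfold trRadius
  split_ifs <;> positivity

theorem trRadius_le (hg : ContDiff ℝ 2 g) (y : E) {γ : ℝ} (hγ : 0 ≤ γ) :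
    trRadius g y γ ≤ γ * (‖gradient g y‖ + ‖hess g y‖) := by
  have h1 : |min (lamMin g y) 0| ≤ ‖hess g y‖ := by
    refine le_trans ?_ (abs_lamMin_le_norm_hess hg y)
    rcases min_cases (lamMin g y) 0 with h | h <;> simp [h.1]
  have h2 := norm_nonneg (gradient g y)
  have h3 := norm_nonneg (hess g y)
  unfold trRadius
  split_ifs <;> gcongr <;> linarith

/-- The decrease of the model ensured by a trial step. -/
theorem IsTrialStep.le_trModel_sub {y s : E} {γ B : ℝ} (hγ : 0 < γ)
    (hB : ‖hess g y‖ ≤ B) (hs : IsTrialStep g y γ s) :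
    1 / 2 * min (γ ^ 2) (min γ (1 / (B + 1))) * secondOrderViolation g y ≤
      trModel g y 0 - trModel g y s := by
  obtain ⟨-, sc, ⟨u, t, hu, rfl, -, -, hmin⟩, hle⟩ := hs
  have hB0 : 0 ≤ B := (norm_nonneg _).trans hB
  have hV := secondOrderViolation_nonneg g y
  rw [trModel_zero]
  by_cases hc : UsesCurvature g y
  · obtain ⟨hu1, hu2, hu3⟩ := hu.1 hc
    have hlt := hc.1
    have hm : min (lamMin g y) 0 = lamMin g y := min_eq_left hlt.le
    have hV' : secondOrderViolation g y = (-lamMin g y) ^ 3 := by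
      rw [secondOrderViolation, max_eq_right hc.2.le, hm, abs_of_neg hlt]
    have hr : trRadius g y γ = γ * -lamMin g y := by
      rw [trRadius, if_pos hc, hm, abs_of_neg hlt]
    have h0 : 0 ≤ γ * -lamMin g y := mul_nonneg hγ.le (by linarith)
    -- Compare with the point of the ray on the boundary of the trust region: the linear term does
    -- not hurt and the quadratic term yields γ²|λ|³/2.
    have h := hmin (γ * -lamMin g y) h0 (by rw [norm_smul, hu1, hr, Real.norm_of_nonneg h0, mul_one])
    rw [trModel_smul, trModel_smul, hu2, inner_smul_right, real_inner_self_eq_norm_sq, hu1] at h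
    rw [trModel_smul, hu2, inner_smul_right, real_inner_self_eq_norm_sq, hu1] at hle
    have h1 : γ * -lamMin g y * inner ℝ u (gradient g y) ≤ 0 :=
      mul_nonpos_of_nonneg_of_nonpos h0 hu3
    calc _ ≤ 1 / 2 * γ ^ 2 * secondOrderViolation g y := by gcongr; exact min_le_left _ _
      _ = - (1 / 2 * (γ * -lamMin g y) ^ 2 * (lamMin g y * 1 ^ 2)) := by rw [hV']; ring
      _ ≤ _ := by linarith
  · have hu' := hu.2 hc
    set G := gradient g y with hG
    have hV' : secondOrderViolation g y = ‖G‖ ^ 2 := by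
      rw [secondOrderViolation, max_eq_left]
      by_cases hlt : lamMin g y < 0
      · exact not_lt.mp fun h => hc ⟨hlt, h⟩
      · rw [min_eq_right (not_lt.mp hlt)]
        simp
    have hr : trRadius g y γ = γ * ‖G‖ := by rw [trRadius, if_neg hc]
    -- The bound by γ keeps the comparison point feasible; τB ≤ 1 lets the curvature consume at most
    -- half of the linear decrease.
    set τ := min γ (1 / (B + 1)) with hτ
    have hτ0 : 0 ≤ τ := le_min hγ.le (by positivity)
    have h := hmin τ hτ0 (by
      rw [norm_smul, hu', norm_neg, hr, Real.norm_of_nonneg hτ0]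
      gcongr
      exact min_le_left _ _)
    have hq : trModel g y (τ • u) ≤ g y - 1 / 2 * τ * ‖G‖ ^ 2 := by
      have h1 : inner ℝ u (hess g y u) ≤ B * ‖G‖ ^ 2 := by
        calc _ ≤ ‖u‖ * ‖hess g y u‖ := real_inner_le_norm _ _
          _ ≤ ‖u‖ * (B * ‖u‖) := by gcongr; exact (hess g y).le_of_opNorm_le hB u
          _ = _ := by rw [hu', norm_neg]; ring
      have h2 : τ * B ≤ 1 := by
        calc τ * B ≤ 1 / (B + 1) * (B + 1) := by
              gcongr
              · exact min_le_right _ _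
              · linarith
          _ = 1 := by field_simp
      have h3 : τ ^ 2 * inner ℝ u (hess g y u) ≤ τ * ‖G‖ ^ 2 := by
        calc _ ≤ τ ^ 2 * (B * ‖G‖ ^ 2) := by gcongr
          _ = (τ * B) * (τ * ‖G‖ ^ 2) := by ring
          _ ≤ 1 * (τ * ‖G‖ ^ 2) := by gcongr
          _ = _ := one_mul _
      have h4 : inner ℝ u G = -‖G‖ ^ 2 := by
        rw [hu', inner_neg_left, real_inner_self_eq_norm_sq]
      rw [trModel_smul, ← hG, h4]
      linarith
    calc _ ≤ 1 / 2 * τ * secondOrderViolation g y := by gcongr; exact min_le_right _ _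
      _ ≤ _ := by rw [hV']; linarith

/-- A trial step without decrease of the model does not move. -/
theorem IsTrialStep.eq_zero_of_trModel_sub_eq_zero {y s : E} {γ : ℝ}
    (hγ : 0 < γ) (hs : IsTrialStep g y γ s) (h : trModel g y 0 - trModel g y s = 0) : s = 0 := by
  have h1 := hs.le_trModel_sub hγ le_rfl
  rw [h] at h1
  have h2 : 0 < 1 / 2 * min (γ ^ 2) (min γ (1 / (‖hess g y‖ + 1))) := by
    have : 0 < min (γ ^ 2) (min γ (1 / (‖hess g y‖ + 1))) :=
      lt_min (by positivity) (lt_min hγ (by positivity))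
    positivity
  have h3 : secondOrderViolation g y = 0 :=
    le_antisymm (nonpos_of_mul_nonpos_right h1 h2) (secondOrderViolation_nonneg g y)
  obtain ⟨h4, h5⟩ := critical_of_secondOrderViolation_eq_zero h3
  have h6 := hs.1
  -- Without violation the gradient rule applies and sets the radius to zero.
  rw [trRadius, if_neg fun hc => absurd hc.1 (not_lt.mpr h5), h4, norm_zero, mul_zero] at h6
  exact norm_le_zero_iff.mp h6

theorem IsTrialStep.trModel_le {y s : E} {γ : ℝ} (hγ : 0 < γ)
    (hs : IsTrialStep g y γ s) : 0 ≤ trModel g y 0 - trModel g y s := by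
  refine le_trans ?_ (hs.le_trModel_sub hγ le_rfl)
  have := secondOrderViolation_nonneg g y
  have : 0 ≤ min (γ ^ 2) (min γ (1 / (‖hess g y‖ + 1))) :=
    le_min (by positivity) (le_min hγ.le (by positivity))
  positivity

/-- The decrease of the cost function at an accepted step. -/
theorem IsTrialStep.mul_le_sub_of_le_trRatio {y s : E} {γ η : ℝ} (hγ : 0 < γ)
    (hs : IsTrialStep g y γ s) (hρ : η ≤ trRatio g y s) :
    η * (trModel g y 0 - trModel g y s) ≤ g y - g (y + s) := by
  by_cases h : trModel g y 0 - trModel g y s = 0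
  · simp [hs.eq_zero_of_trModel_sub_eq_zero hγ h]
  · rw [trRatio, if_neg h] at hρ
    exact (le_div_iff₀ (lt_of_le_of_ne (hs.trModel_le hγ) (Ne.symm h))).mp hρ

theorem exists_isCauchyDirection (hg : ContDiff ℝ 2 g) (y : E) : ∃ u, IsCauchyDirection g y u := by
  by_cases hc : UsesCurvature g y
  · have hE : Nontrivial E := by
      by_contra hE
      have := not_nontrivial_iff_subsingleton.mp hE
      exact absurd hc.1 (by simp [lamMin_of_subsingleton])
    obtain ⟨u, hu, hHu⟩ := exists_unit_eigenvector_lamMin hg y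
    rcases le_total (inner ℝ u (gradient g y)) 0 with h | h
    · exact ⟨u, fun _ => ⟨hu, hHu, h⟩, fun h => absurd hc h⟩
    · exact ⟨-u, fun _ => ⟨by simpa using hu, by simp [hHu], by simpa using h⟩,
        fun h => absurd hc h⟩
  · exact ⟨_, fun h => absurd h hc, fun _ => rfl⟩

theorem exists_isTrialStep (hg : ContDiff ℝ 2 g) (y : E) {γ : ℝ} (hγ : 0 ≤ γ) :
    ∃ s, IsTrialStep g y γ s := by
  obtain ⟨u, hu⟩ := exists_isCauchyDirection hg y
  have hr := trRadius_nonneg g y hγ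
  suffices ∃ t : ℝ, 0 ≤ t ∧ ‖t • u‖ ≤ trRadius g y γ ∧ ∀ t' : ℝ, 0 ≤ t' →
      ‖t' • u‖ ≤ trRadius g y γ → trModel g y (t • u) ≤ trModel g y (t' • u) by
    obtain ⟨t, h0, h1, h2⟩ := this
    exact ⟨t • u, h1, t • u, ⟨u, t, hu, rfl, h0, h1, h2⟩, le_rfl⟩
  by_cases hu0 : u = 0
  · exact ⟨0, le_rfl, by simpa using hr, by simp [hu0]⟩
  have hun : 0 < ‖u‖ := norm_pos_iff.mpr hu0
  have hiff : ∀ t : ℝ, 0 ≤ t → (‖t • u‖ ≤ trRadius g y γ ↔ t ≤ trRadius g y γ / ‖u‖) := by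
    intro t ht
    rw [norm_smul, Real.norm_of_nonneg ht, le_div_iff₀ hun]
  obtain ⟨t, ⟨ht0, ht1⟩, ht⟩ :=
    (isCompact_Icc (a := (0 : ℝ)) (b := trRadius g y γ / ‖u‖)).exists_isMinOn
    (Set.nonempty_Icc.mpr (by positivity)) (f := fun t => trModel g y (t • u))
    ((continuous_trModel g y).comp (continuous_id.smul continuous_const)).continuousOn
  exact ⟨t, ht0, (hiff t ht0).mpr ht1, fun t' h0 h1 => ht ⟨h0, (hiff t' h0).mp h1⟩⟩

variable {p : TRParams} {Φ : E → E}

theorem exists_trStep (p : TRParams) (Φ : E → E) (hg : ContDiff ℝ 2 g) (y : E) {γ : ℝ}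
    (hγ : 0 ≤ γ) : ∃ y' γ', TRStep p Φ g y γ y' γ' := by
  obtain ⟨s, hs⟩ := exists_isTrialStep hg y hγ
  rcases le_or_gt p.η (trRatio g y s) with h | h
  · exact ⟨_, p.γlo, s, hs, Or.inl ⟨h, rfl, le_rfl, p.γlo_le_γup⟩⟩
  · exact ⟨_, _, s, hs, Or.inr ⟨h, rfl, rfl⟩⟩

theorem TRStep.radiusFactor_pos {y y' : E} {γ γ' : ℝ} (hγ : 0 < γ) (h : TRStep p Φ g y γ y' γ') :
    0 < γ' := by
  obtain ⟨s, -, ⟨-, -, h⟩ | ⟨-, -, rfl⟩⟩ := h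
  · exact p.γlo_pos.trans_le h.1
  · exact mul_pos p.γc_pos hγ

theorem TRStep.le (hΦ : ∀ z, g (Φ z) = g z) {y y' : E} {γ γ' : ℝ}
    (hγ : 0 < γ) (h : TRStep p Φ g y γ y' γ') : g y' ≤ g y := by
  obtain ⟨s, hs, ⟨hρ, rfl, -⟩ | ⟨-, rfl, -⟩⟩ := h
  · have h1 := hs.mul_le_sub_of_le_trRatio hγ hρ
    have h2 := mul_nonneg p.η_pos.le (hs.trModel_le hγ)
    rw [hΦ]
    linarith
  · exact le_rfl

theorem exists_isTRRun (p : TRParams) (Φ : E → E) (hg : ContDiff ℝ 2 g) (yin : E) :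
    ∃ y γ, IsTRRun p Φ g yin y γ := by
  have hstep : ∀ a : {a : E × ℝ // 0 < a.2}, ∃ b : {b : E × ℝ // 0 < b.2},
      TRStep p Φ g a.1.1 a.1.2 b.1.1 b.1.2 := by
    intro a
    obtain ⟨y', γ', h⟩ := exists_trStep p Φ hg a.1.1 a.2.le
    exact ⟨⟨(y', γ'), h.radiusFactor_pos a.2⟩, h⟩
  choose next hnext using hstep
  let seq : ℕ → {a : E × ℝ // 0 < a.2} :=
    fun k => Nat.rec ⟨(Φ yin, p.γlo), p.γlo_pos⟩ (fun _ a => next a) k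
  exact ⟨fun k => (seq k).1.1, fun k => (seq k).1.2, rfl, ⟨le_rfl, p.γlo_le_γup⟩,
    fun k => hnext (seq k)⟩

end Step

/-! ### Accumulation points of the hooked method. -/

section Convergence

variable {E : Type*} [NormedAddCommGroup E] [InnerProductSpace ℝ E] [FiniteDimensional ℝ E]
  {g : E → ℝ} {p : TRParams} {Φ : E → E} {yin : E} {y : ℕ → E} {γ : ℕ → ℝ}

theorem IsTRRun.radiusFactor_pos (h : IsTRRun p Φ g yin y γ) (k : ℕ) : 0 < γ k := by
  induction k with
  | zero => exact p.γlo_pos.trans_le h.2.1.1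
  | succ k ih => exact (h.2.2 k).radiusFactor_pos ih

theorem IsTRRun.antitone (hΦ : ∀ z, g (Φ z) = g z)
    (h : IsTRRun p Φ g yin y γ) : Antitone fun k => g (y k) :=
  antitone_nat_of_succ_le fun k => (h.2.2 k).le hΦ (h.radiusFactor_pos k)

theorem IsTRRun.mem_range (h : IsTRRun p Φ g yin y γ) (k : ℕ) : y k ∈ Set.range Φ := by
  induction k with
  | zero => exact ⟨yin, h.1.symm⟩
  | succ k ih =>
    obtain ⟨s, -, ⟨-, h, -⟩ | ⟨-, h, -⟩⟩ := h.2.2 k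
    · exact ⟨_, h.symm⟩
    · rwa [h]

/-- Around a point which is not second-order critical, steps of small relative radius are accepted,
and steps of relative radius bounded away from zero give a uniform decrease of the model. -/
theorem exists_nhds_forall_isTrialStep (hg : ContDiff ℝ 2 g) {η : ℝ} (hη : η < 1) {x : E}
    (hx : secondOrderViolation g x ≠ 0) :
    ∃ U ∈ 𝓝 x, ∃ γs > 0, (∀ y ∈ U, ∀ γ s, 0 < γ → γ ≤ γs → IsTrialStep g y γ s →
        η ≤ trRatio g y s) ∧
      ∀ γm > 0, ∃ c > 0, ∀ y ∈ U, ∀ γ s, γm ≤ γ → IsTrialStep g y γ s →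
        c ≤ trModel g y 0 - trModel g y s := by
  set V := secondOrderViolation g x with hV
  have hV0 : 0 < V := lt_of_le_of_ne (secondOrderViolation_nonneg g x) (Ne.symm hx)
  set B := ‖hess g x‖ + 1 with hB
  set M := ‖gradient g x‖ + 1 + B with hM
  have hB0 : 0 < B := by positivity
  have hM0 : 0 < M := by positivity
  -- Chosen so that ε(γM)² = (1 - η) · γ²/2 · V/2, a share 1 - η of the guaranteed model decrease
  -- where the violation exceeds V/2.
  set ε := (1 - η) * (V / 4) / M ^ 2 with hε
  have hε0 : 0 < ε := by
    have : 0 < 1 - η := by linarith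
    positivity
  obtain ⟨δ, hδ, hT⟩ := exists_ball_abs_sub_trModel_le hg x hε0
  have e1 : ∀ᶠ y in 𝓝 x, V / 2 < secondOrderViolation g y :=
    (continuous_secondOrderViolation hg).continuousAt.eventually (lt_mem_nhds (by linarith))
  have e2 : ∀ᶠ y in 𝓝 x, ‖hess g y‖ < B :=
    (continuous_hess hg).norm.continuousAt.eventually (gt_mem_nhds (by linarith))
  have e3 : ∀ᶠ y in 𝓝 x, ‖gradient g y‖ < ‖gradient g x‖ + 1 :=
    (continuous_gradient hg).norm.continuousAt.eventually (gt_mem_nhds (by linarith))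
  -- The first bound on γ makes the minimum in the decrease estimate equal γ²; the second keeps ‖s‖
  -- below δ.
  refine ⟨_, e1.and (e2.and (e3.and (Metric.ball_mem_nhds x hδ))),
    min (1 / (B + 1)) (δ / (2 * M)), lt_min (by positivity) (by positivity), ?_, ?_⟩
  · rintro y ⟨h1, h2, h3, h4⟩ γ s hγ hγs hs
    have hγ1 : γ ≤ 1 / (B + 1) := hγs.trans (min_le_left _ _)
    have hγ2 : γ ≤ δ / (2 * M) := hγs.trans (min_le_right _ _)
    have hγ3 : γ ≤ 1 := hγ1.trans (by rw [div_le_one (by positivity)]; linarith)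
    have hdec := hs.le_trModel_sub hγ h2.le
    rw [min_eq_left hγ1, min_eq_left (by nlinarith)] at hdec
    have hpos : 0 < 1 / 2 * γ ^ 2 * secondOrderViolation g y := by
      have : 0 < secondOrderViolation g y := by linarith
      positivity
    have hsn : ‖s‖ ≤ γ * M := by
      refine hs.1.trans ((trRadius_le hg y hγ.le).trans ?_)
      gcongr
      linarith
    have hsδ : ‖s‖ < δ := by
      calc ‖s‖ ≤ γ * M := hsn
        _ ≤ δ / (2 * M) * M := by gcongr
        _ = δ / 2 := by field_simp
        _ < δ := by linarith
    have herr := hT y s (by rw [← dist_eq_norm]; exact h4) hsδ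
    have herr2 : ε * ‖s‖ ^ 2 ≤ (1 - η) * (1 / 2 * γ ^ 2 * secondOrderViolation g y) := by
      have h1η : 0 ≤ 1 - η := by linarith
      calc ε * ‖s‖ ^ 2 ≤ ε * (γ * M) ^ 2 := by gcongr
        _ = (1 - η) * (1 / 2 * γ ^ 2 * (V / 2)) := by rw [hε]; field_simp; ring
        _ ≤ _ := by gcongr
    have hden : 0 < trModel g y 0 - trModel g y s := hpos.trans_le hdec
    rw [trRatio, if_neg hden.ne', le_div_iff₀ hden]
    have h5 : (1 - η) * (1 / 2 * γ ^ 2 * secondOrderViolation g y) ≤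
        (1 - η) * (trModel g y 0 - trModel g y s) :=
      mul_le_mul_of_nonneg_left hdec (by linarith)
    have h6 := (abs_le.mp herr).2
    rw [trModel_zero] at h5 ⊢
    linarith
  · intro γm hγm
    have hq : 0 < min (γm ^ 2) (min γm (1 / (B + 1))) :=
      lt_min (by positivity) (lt_min hγm (by positivity))
    refine ⟨1 / 2 * min (γm ^ 2) (min γm (1 / (B + 1))) * (V / 2), by positivity, ?_⟩
    rintro y ⟨h1, h2, -, -⟩ γ s hγ hs
    refine le_trans ?_ (hs.le_trModel_sub (hγm.trans_le hγ) h2.le)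
    have := hγm.trans_le hγ
    gcongr

/-- Accumulation points of the trust-region method with a hook are second-order critical. -/
theorem IsTRRun.secondOrderViolation_eq_zero (hg : ContDiff ℝ 2 g) (hΦ : ∀ z, g (Φ z) = g z)
    (h : IsTRRun p Φ g yin y γ) {x : E} (hx : MapClusterPt x atTop y) :
    secondOrderViolation g x = 0 := by
  by_contra hne
  have hanti := h.antitone hΦ
  have hlb : ∀ k, g x ≤ g (y k) := by
    intro k
    have hc : MapClusterPt (g x) atTop (fun j => g (y j)) :=
      hx.continuousAt_comp (f := g) hg.continuous.continuousAt
    exact isClosed_Iic.mem_of_mapClusterPt hc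
      ((eventually_ge_atTop k).mono fun j hj => hanti hj)
  obtain ⟨U, hU, γs, hγs, hacc, hdec⟩ := exists_nhds_forall_isTrialStep hg p.η_lt_one hne
  set γm := min p.γlo (p.γc * γs) with hγm
  have hγm0 : 0 < γm := lt_min p.γlo_pos (mul_pos p.γc_pos hγs)
  obtain ⟨c, hc, hdec⟩ := hdec γm hγm0
  -- Only the last iteration matters: an accepted step resets the factor to at least `p.γlo`, and a
  -- rejected one took place at the same point of `U`, so its factor exceeded γs.
  have hlow : ∀ k, y k ∈ U → γm ≤ γ k := by
    intro k hk
    cases k with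
    | zero => exact (min_le_left _ _).trans h.2.1.1
    | succ k =>
      obtain ⟨s, hs, ⟨-, -, h1⟩ | ⟨h0, h1, h2⟩⟩ := h.2.2 k
      · exact (min_le_left _ _).trans h1.1
      · rw [h1] at hk
        have : γs < γ k := by
          by_contra hle
          exact absurd h0 (not_lt.mpr
            (hacc _ hk _ _ (h.radiusFactor_pos k) (not_lt.mp hle) hs))
        rw [h2]
        exact (min_le_right _ _).trans (mul_le_mul_of_nonneg_left this.le p.γc_pos.le)
  have hnear : ∃ᶠ k in atTop, y k ∈ U ∩ {z | g z < g x + p.η * c} :=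
    hx.frequently (inter_mem hU (hg.continuous.continuousAt.eventually
      (gt_mem_nhds (by have := mul_pos p.η_pos hc; linarith))))
  obtain ⟨k, hkU, hk⟩ := hnear.exists
  -- Until a step from `y k` is accepted the iterate stays put and the factor shrinks geometrically,
  -- which `hlow` forbids forever. Acceptance costs η·c, pushing g below its lower bound g x.
  have halt : ∀ i, (y (k + i) = y k ∧ γ (k + i) = p.γc ^ i * γ k) ∨
      g (y (k + i)) ≤ g (y k) - p.η * c := by
    intro i
    induction i with
    | zero => exact Or.inl ⟨rfl, by simp⟩
    | succ i ih =>
      rcases ih with ⟨h1, h2⟩ | h1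
      · obtain ⟨s, hs, ⟨h3, h4, -⟩ | ⟨-, h4, h5⟩⟩ := h.2.2 (k + i)
        · right
          have h6 := hs.mul_le_sub_of_le_trRatio (h.radiusFactor_pos _) h3
          have h7 := hdec _ (h1 ▸ hkU) _ _ (hlow _ (h1 ▸ hkU)) hs
          have h8 := mul_le_mul_of_nonneg_left h7 p.η_pos.le
          rw [← add_assoc, h4, hΦ, ← h1]
          linarith
        · left
          rw [← add_assoc, h4, h5, h2, h1]
          exact ⟨rfl, by ring⟩
      · exact Or.inr ((hanti (by omega : k + i ≤ k + (i + 1))).trans h1)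
  have hsmall : ∀ᶠ i in atTop, p.γc ^ i * γ k < γm := by
    have ht := (tendsto_pow_atTop_nhds_zero_of_lt_one p.γc_pos.le p.γc_lt_one).mul_const (γ k)
    rw [zero_mul] at ht
    exact ht.eventually (gt_mem_nhds hγm0)
  obtain ⟨i, hi⟩ := hsmall.exists
  rcases halt i with ⟨h1, h2⟩ | h1
  · have := hlow (k + i) (h1 ▸ hkU)
    rw [h2] at this
    linarith
  · have h2 : g (y k) < g x + p.η * c := hk
    linarith [hlb (k + i)]

end Convergence

/-! ### Singular value decomposition and Schur complement. -/

section SVD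

/-- A matrix of rank at most `r` has a singular value decomposition with `r` singular values. -/
theorem exists_isSVD {m n r : ℕ} {X : Matrix (Fin m) (Fin n) ℝ} (hX : X.rank ≤ r) :
    ∃ (U : Matrix (Fin m) (Fin r) ℝ) (σ : Fin r → ℝ) (V : Matrix (Fin n) (Fin r) ℝ),
      IsSVD X U σ V := by
  have hA : (Xᵀ * X).IsHermitian := by
    simpa [Matrix.conjTranspose_eq_transpose_of_trivial] using
      Matrix.isHermitian_conjTranspose_mul_self X
  set ev := hA.eigenvalues with hev
  set W : Matrix (Fin n) (Fin n) ℝ := hA.eigenvectorUnitary.1 with hW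
  have hWW : Wᵀ * W = 1 := by
    have := Unitary.coe_star_mul_self hA.eigenvectorUnitary
    rwa [Matrix.star_eq_conjTranspose, Matrix.conjTranspose_eq_transpose_of_trivial] at this
  have hWW' : W * Wᵀ = 1 := mul_eq_one_comm.mp hWW
  -- The columns of `Y` are orthogonal with squared norms the eigenvalues of XᵀX; normalizing the
  -- nonzero ones gives the left singular vectors.
  set Y := X * W with hY
  have hYY : Yᵀ * Y = Matrix.diagonal ev := by
    have h1 : Xᵀ * X * W = W * Matrix.diagonal ev := by
      ext i j
      have h2 := congrFun (hA.mulVec_eigenvectorBasis j) i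
      rw [Matrix.mul_diagonal]
      simpa [Matrix.mul_apply, Matrix.mulVec, dotProduct, hW, hev,
        Matrix.IsHermitian.eigenvectorUnitary_apply, mul_comm] using h2
    rw [hY, Matrix.transpose_mul, Matrix.mul_assoc, ← Matrix.mul_assoc Xᵀ, h1, ← Matrix.mul_assoc,
      hWW, Matrix.one_mul]
  have hdot : ∀ j k, ∑ i, Y i j * Y i k = if j = k then ev j else 0 := by
    intro j k
    have := congrFun (congrFun hYY j) k
    simpa [Matrix.mul_apply, Matrix.diagonal_apply] using this
  have hnn : ∀ j, 0 ≤ ev j := by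
    intro j
    have h := hdot j j
    rw [if_pos rfl] at h
    rw [← h]
    exact Finset.sum_nonneg fun i _ => mul_self_nonneg _
  have hzero : ∀ i j, ev j = 0 → Y i j = 0 := by
    intro i j hj
    have h := hdot j j
    rw [if_pos rfl, hj, Finset.sum_eq_zero_iff_of_nonneg fun i _ => mul_self_nonneg _] at h
    exact mul_self_eq_zero.mp (h i (Finset.mem_univ i))
  have hXY : X = Y * Wᵀ := by rw [hY, Matrix.mul_assoc, hWW', Matrix.mul_one]
  have hcard : Fintype.card {j // ev j ≠ 0} ≤ Fintype.card (Fin r) := by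
    rw [← hA.rank_eq_card_non_zero_eigs, Matrix.rank_transpose_mul_self, Fintype.card_fin]
    exact hX
  -- The nonzero eigenvalues, at most r in number, are placed in `Fin r`; unused slots get zero
  -- singular values and zero columns, where no orthonormality is required.
  obtain ⟨e⟩ := Function.Embedding.nonempty_of_card_le hcard
  set σ : Fin r → ℝ := Function.extend e (fun j => √(ev j)) 0 with hσ
  have hσe : ∀ j, σ (e j) = √(ev j) := fun j => e.injective.extend_apply _ _ j
  have hrange : ∀ a, σ a ≠ 0 → ∃ j, e j = a := by
    intro a ha
    by_contra h
    exact ha (Function.extend_apply' _ _ a h)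
  have hsq : ∀ j : {j // ev j ≠ 0}, √(ev j) ≠ 0 := fun j =>
    (Real.sqrt_pos.mpr (lt_of_le_of_ne (hnn j) (Ne.symm j.2))).ne'
  set U : Matrix (Fin m) (Fin r) ℝ :=
    Matrix.of fun i => Function.extend e (fun j => Y i j / √(ev j)) 0 with hU
  set V : Matrix (Fin n) (Fin r) ℝ := Matrix.of fun i => Function.extend e (fun j => W i j) 0 with hV
  have hUe : ∀ i j, U i (e j) = Y i j / √(ev j) := fun i j =>
    e.injective.extend_apply (fun j => Y i j / √(ev j)) 0 j
  have hVe : ∀ i j, V i (e j) = W i j := fun i j =>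
    e.injective.extend_apply (fun j => W i j) 0 j
  refine ⟨U, σ, V, ?_, ?_, ?_, ?_⟩
  · intro a
    by_cases ha : σ a = 0
    · exact ha.ge
    · obtain ⟨j, rfl⟩ := hrange a ha
      rw [hσe]
      positivity
  · intro a b ha hb
    obtain ⟨j, rfl⟩ := hrange a ha
    obtain ⟨k, rfl⟩ := hrange b hb
    have h : ∀ i, Uᵀ (e j) i * U i (e k) = (√(ev j) * √(ev k))⁻¹ * (Y i j * Y i k) := by
      intro i
      rw [Matrix.transpose_apply, hUe, hUe]
      ring
    rw [Matrix.mul_apply, Finset.sum_congr rfl fun i _ => h i, ← Finset.mul_sum, hdot]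
    by_cases hjk : j = k
    · subst hjk
      rw [if_pos rfl, if_pos rfl, Real.mul_self_sqrt (hnn _)]
      exact inv_mul_cancel₀ j.2
    · rw [if_neg (fun h => hjk (Subtype.ext h)), if_neg (fun h => hjk (e.injective h)), mul_zero]
  · intro a b ha hb
    obtain ⟨j, rfl⟩ := hrange a ha
    obtain ⟨k, rfl⟩ := hrange b hb
    have h := congrFun (congrFun hWW j) k
    rw [Matrix.mul_apply, Matrix.one_apply] at h
    simp only [Matrix.mul_apply, Matrix.transpose_apply, hVe, e.injective.eq_iff, Subtype.ext_iff]
    simpa using h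
  · ext i k
    have h1 : (U * Matrix.diagonal σ * Vᵀ) i k = ∑ a, U i a * σ a * V k a := by
      rw [Matrix.mul_apply]
      simp [Matrix.mul_diagonal]
    have h2 : ∑ j : {j // ev j ≠ 0}, Y i j * W k j = ∑ a, U i a * σ a * V k a := by
      refine Fintype.sum_of_injective e e.injective _ _ (fun a ha => ?_) fun j => ?_
      · have : σ a = 0 := by
          by_contra h
          exact ha (hrange a h)
        rw [this, mul_zero, zero_mul]
      · rw [hUe, hσe, hVe, div_mul_cancel₀ _ (hsq j)]
    have h3 : ∑ j : {j // ev j ≠ 0}, Y i j * W k j = ∑ j, Y i j * W k j := by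
      refine Fintype.sum_of_injective Subtype.val Subtype.val_injective _ _ (fun j hj => ?_)
        fun j => rfl
      have : ev j = 0 := by
        by_contra h
        exact hj ⟨⟨j, h⟩, rfl⟩
      rw [hzero i j this, zero_mul]
    rw [h1, ← h2, h3, hXY, Matrix.mul_apply]
    rfl

/-- A matrix of rank at most `r` agrees with its Schur-complement approximation with respect to
any nonsingular `r × r` compression. -/
theorem Matrix.mul_inv_compression_mul_eq {m n r : ℕ} {X : Matrix (Fin m) (Fin n) ℝ}
    (hX : X.rank ≤ r) (L : Matrix (Fin m) (Fin r) ℝ) (R : Matrix (Fin n) (Fin r) ℝ)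
    (h : (Lᵀ * X * R).det ≠ 0) : X * R * (Lᵀ * X * R)⁻¹ * (Lᵀ * X) = X := by
  -- Factoring X through dimension r turns the compression into a product of two square matrices,
  -- each then invertible.
  obtain ⟨U, σ, V, hs⟩ := exists_isSVD hX
  set M := U * Matrix.diagonal σ with hM
  have hXM : X = M * Vᵀ := hs.eq
  set P := Lᵀ * M with hP
  set Q := Vᵀ * R with hQ
  have hPQ : Lᵀ * X * R = P * Q := by rw [hXM, hP, hQ]; simp only [Matrix.mul_assoc]
  rw [hPQ, Matrix.det_mul] at h
  have hPu : IsUnit P.det := (left_ne_zero_of_mul h).isUnit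
  have hQu : IsUnit Q.det := (right_ne_zero_of_mul h).isUnit
  rw [hPQ, Matrix.mul_inv_rev]
  have h1 : X * R = M * Q := by rw [hXM, hQ, Matrix.mul_assoc]
  have h2 : Lᵀ * X = P * Vᵀ := by rw [hXM, hP, Matrix.mul_assoc Lᵀ]
  rw [h1, h2]
  calc M * Q * (Q⁻¹ * P⁻¹) * (P * Vᵀ) = M * (Q * Q⁻¹) * (P⁻¹ * P) * Vᵀ := by
        simp only [Matrix.mul_assoc]
    _ = X := by
      rw [Matrix.mul_nonsing_inv _ hQu, Matrix.nonsing_inv_mul _ hPu, Matrix.mul_one,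
        Matrix.mul_one, hXM]

end SVD

/-! ### The lift, balanced factors and rebalancing. -/

section Factors

variable {m n r : ℕ}

/-- The pair `(L, R)` as an element of the factor space. -/
def factorPair (L : Matrix (Fin m) (Fin r) ℝ) (R : Matrix (Fin n) (Fin r) ℝ) :
    FactorSpace m n r :=
  WithLp.toLp 2 (Sum.elim (fun p => L p.1 p.2) fun p => R p.1 p.2)

@[simp]
theorem leftFactor_factorPair (L : Matrix (Fin m) (Fin r) ℝ) (R : Matrix (Fin n) (Fin r) ℝ) :
    leftFactor (factorPair L R) = L := rfl

@[simp]
theorem rightFactor_factorPair (L : Matrix (Fin m) (Fin r) ℝ) (R : Matrix (Fin n) (Fin r) ℝ) :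
    rightFactor (factorPair L R) = R := rfl

theorem leftFactor_add_smul (z s : FactorSpace m n r) (t : ℝ) :
    leftFactor (z + t • s) = leftFactor z + t • leftFactor s := rfl

theorem rightFactor_add_smul (z s : FactorSpace m n r) (t : ℝ) :
    rightFactor (z + t • s) = rightFactor z + t • rightFactor s := rfl

theorem lrLift_add_smul (z s : FactorSpace m n r) (t : ℝ) :
    lrLift (z + t • s) = lrLift z +
      t • (leftFactor s * (rightFactor z)ᵀ + leftFactor z * (rightFactor s)ᵀ) +
      t ^ 2 • (leftFactor s * (rightFactor s)ᵀ) := by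
  simp only [lrLift, leftFactor_add_smul, rightFactor_add_smul, Matrix.transpose_add,
    Matrix.transpose_smul, Matrix.add_mul, Matrix.mul_add, Matrix.smul_mul, Matrix.mul_smul,
    smul_add, smul_smul, sq]
  abel

theorem rank_lrLift_le (z : FactorSpace m n r) : (lrLift z).rank ≤ r :=
  (Matrix.rank_mul_le_left _ _).trans (Matrix.rank_le_width _)

theorem exists_lrLift_eq {X : Matrix (Fin m) (Fin n) ℝ} (hX : X.rank ≤ r) :
    ∃ z : FactorSpace m n r, lrLift z = X := by
  obtain ⟨U, σ, V, h⟩ := exists_isSVD hX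
  exact ⟨factorPair (U * Matrix.diagonal σ) V, h.eq.symm⟩

theorem contDiff_lrLift {k : WithTop ℕ∞} :
    ContDiff ℝ k (lrLift : FactorSpace m n r → Matrix (Fin m) (Fin n) ℝ) := by
  have h : (lrLift : FactorSpace m n r → Matrix (Fin m) (Fin n) ℝ) = fun z =>
      ∑ i, ∑ j, (∑ a, z (Sum.inl (i, a)) * z (Sum.inr (j, a))) • Matrix.single i j (1 : ℝ) := by
    ext1 z
    conv_lhs => rw [Matrix.matrix_eq_sum_single (lrLift z)]
    simp [lrLift, Matrix.mul_apply, leftFactor, rightFactor, Matrix.smul_single]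
  rw [h]
  fun_prop

theorem continuous_leftFactor :
    Continuous (leftFactor : FactorSpace m n r → Matrix (Fin m) (Fin r) ℝ) :=
  continuous_matrix fun i a => by unfold leftFactor; simp only [Matrix.of_apply]; fun_prop

theorem continuous_rightFactor :
    Continuous (rightFactor : FactorSpace m n r → Matrix (Fin n) (Fin r) ℝ) :=
  continuous_matrix fun i a => by unfold rightFactor; simp only [Matrix.of_apply]; fun_prop

/-- The factors have the same Gram matrix, and it is diagonal. -/
def IsBalanced (z : FactorSpace m n r) : Prop :=
  (leftFactor z)ᵀ * leftFactor z = Matrix.diagonal ((leftFactor z)ᵀ * leftFactor z).diag ∧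
    (rightFactor z)ᵀ * rightFactor z = (leftFactor z)ᵀ * leftFactor z

/-- Rebalancing need not be continuous, so limits inherit only this closed consequence of it. -/
theorem isClosed_isBalanced : IsClosed {z : FactorSpace m n r | IsBalanced z} := by
  have hL : Continuous fun z : FactorSpace m n r => (leftFactor z)ᵀ * leftFactor z :=
    continuous_leftFactor.matrix_transpose.matrix_mul continuous_leftFactor
  have hR : Continuous fun z : FactorSpace m n r => (rightFactor z)ᵀ * rightFactor z :=
    continuous_rightFactor.matrix_transpose.matrix_mul continuous_rightFactor
  exact (isClosed_eq hL hL.matrix_diag.matrix_diagonal).inter (isClosed_eq hR hL)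

/-- With G the common diagonal Gram matrix, ‖z‖² = 2 tr G and ‖LRᵀ‖² = tr G², so each diagonal entry
of G is at most ‖LRᵀ‖. -/
theorem IsBalanced.norm_sq_le {z : FactorSpace m n r} (hz : IsBalanced z) :
    ‖z‖ ^ 2 ≤ 2 * r * ‖lrLift z‖ := by
  set G := (leftFactor z)ᵀ * leftFactor z with hG
  have hGaa : ∀ a, G a a = ∑ i, z (Sum.inl (i, a)) ^ 2 := by
    intro a
    simp [hG, Matrix.mul_apply, leftFactor, sq]
  have hGaa' : ∀ a, G a a = ∑ j, z (Sum.inr (j, a)) ^ 2 := by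
    intro a
    rw [hG, ← hz.2]
    simp [Matrix.mul_apply, rightFactor, sq]
  have hnorm : ‖z‖ ^ 2 = 2 * ∑ a, G a a := by
    rw [EuclideanSpace.norm_sq_eq, Fintype.sum_sum_type, Fintype.sum_prod_type,
      Fintype.sum_prod_type, two_mul]
    simp only [Real.norm_eq_abs, sq_abs]
    congr 1
    · rw [Finset.sum_comm]
      exact Finset.sum_congr rfl fun a _ => (hGaa a).symm
    · rw [Finset.sum_comm]
      exact Finset.sum_congr rfl fun a _ => (hGaa' a).symm
  have hfro : ‖lrLift z‖ ^ 2 = ∑ a, G a a ^ 2 := by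
    have h1 : ‖lrLift z‖ ^ 2 = (lrLift z * (lrLift z)ᵀ).trace := by
      rw [Matrix.frobenius_norm_def, ← Real.sqrt_eq_rpow, Real.sq_sqrt (by positivity)]
      simp [Matrix.trace, Matrix.mul_apply, sq]
    have h2 : (lrLift z * (lrLift z)ᵀ).trace = (G * G).trace := by
      rw [lrLift, Matrix.transpose_mul, Matrix.transpose_transpose, Matrix.mul_assoc,
        Matrix.trace_mul_comm, ← Matrix.mul_assoc, Matrix.mul_assoc, hz.2]
    have h3 : G = Matrix.diagonal G.diag := hz.1
    rw [h1, h2, h3, Matrix.diagonal_mul_diagonal, Matrix.trace_diagonal]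
    simp [sq]
  have hle : ∀ a, G a a ≤ ‖lrLift z‖ := by
    intro a
    refine le_of_sq_le_sq ?_ (norm_nonneg _)
    rw [hfro]
    exact Finset.single_le_sum (f := fun a => G a a ^ 2) (fun _ _ => sq_nonneg _)
      (Finset.mem_univ a)
  calc ‖z‖ ^ 2 = 2 * ∑ a, G a a := hnorm
    _ ≤ 2 * ∑ _a : Fin r, ‖lrLift z‖ := by gcongr with a; exact hle a
    _ = _ := by simp; ring

variable {Φ : FactorSpace m n r → FactorSpace m n r}

theorem exists_isSVDRebalancing (m n r : ℕ) :
    ∃ Φ : FactorSpace m n r → FactorSpace m n r, IsSVDRebalancing Φ := by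
  -- Choosing per matrix, not per pair, makes the map constant on fibres of the lift.
  choose U σ V h using fun X : {X : Matrix (Fin m) (Fin n) ℝ // X.rank ≤ r} => exists_isSVD X.2
  let F : {X : Matrix (Fin m) (Fin n) ℝ // X.rank ≤ r} → FactorSpace m n r := fun X =>
    factorPair (U X * Matrix.diagonal fun a => √(σ X a)) (V X * Matrix.diagonal fun a => √(σ X a))
  exact ⟨fun y => F ⟨lrLift y, rank_lrLift_le y⟩,
    fun y => ⟨_, _, _, h ⟨lrLift y, rank_lrLift_le y⟩, rfl, rfl⟩,
    fun y y' hy => congrArg F (Subtype.ext hy)⟩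

theorem IsSVDRebalancing.lrLift_apply (hΦ : IsSVDRebalancing Φ) (y : FactorSpace m n r) :
    lrLift (Φ y) = lrLift y := by
  obtain ⟨U, σ, V, h, hL, hR⟩ := hΦ.svd y
  rw [lrLift, hL, hR, Matrix.transpose_mul, Matrix.diagonal_transpose, Matrix.mul_assoc,
    ← Matrix.mul_assoc (Matrix.diagonal _) (Matrix.diagonal _), Matrix.diagonal_mul_diagonal]
  simp only [Real.mul_self_sqrt (h.nonneg _)]
  rw [← Matrix.mul_assoc, ← h.eq]

/-- The scaling annihilates columns with zero singular value, so partial orthonormality suffices. -/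
theorem gram_mul_diagonal_sqrt {k : ℕ} {U : Matrix (Fin k) (Fin r) ℝ} {σ : Fin r → ℝ}
    (hσ : ∀ a, 0 ≤ σ a)
    (hU : ∀ a b, σ a ≠ 0 → σ b ≠ 0 → (Uᵀ * U) a b = if a = b then 1 else 0) :
    (U * Matrix.diagonal fun a => √(σ a))ᵀ * (U * Matrix.diagonal fun a => √(σ a)) =
      Matrix.diagonal σ := by
  rw [Matrix.transpose_mul, Matrix.diagonal_transpose, Matrix.mul_assoc, ← Matrix.mul_assoc Uᵀ]
  ext a b
  rw [Matrix.diagonal_mul, Matrix.mul_diagonal, Matrix.diagonal_apply]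
  by_cases ha : σ a = 0
  · simp [ha]
  by_cases hb : σ b = 0
  · by_cases hab : a = b
    · exact absurd (hab ▸ hb) ha
    · simp [hb, hab]
  · rw [hU a b ha hb]
    by_cases hab : a = b
    · subst hab
      simp [Real.mul_self_sqrt (hσ a)]
    · simp [hab]

theorem IsSVDRebalancing.isBalanced (hΦ : IsSVDRebalancing Φ) (y : FactorSpace m n r) :
    IsBalanced (Φ y) := by
  obtain ⟨U, σ, V, h, hL, hR⟩ := hΦ.svd y
  have h1 := gram_mul_diagonal_sqrt h.nonneg h.left
  have h2 := gram_mul_diagonal_sqrt h.nonneg h.right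
  rw [IsBalanced, hL, hR, h1, h2]
  simp

end Factors

/-! ### Second-order critical points. -/

section Critical

variable {E : Type*} [NormedAddCommGroup E] [InnerProductSpace ℝ E] [FiniteDimensional ℝ E]
  {g : E → ℝ}

/-- The model at `x` never falls below g x, so only the Taylor error can be lost. -/
theorem exists_ball_sub_le_of_secondOrderViolation_eq_zero (hg : ContDiff ℝ 2 g) {x : E}
    (hx : secondOrderViolation g x = 0) {ε : ℝ} (hε : 0 < ε) :
    ∃ δ > 0, ∀ s : E, ‖s‖ < δ → g x - ε * ‖s‖ ^ 2 ≤ g (x + s) := by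
  obtain ⟨δ, hδ, h⟩ := exists_ball_abs_sub_trModel_le hg x hε
  refine ⟨δ, hδ, fun s hs => ?_⟩
  obtain ⟨hgrad, hlam⟩ := critical_of_secondOrderViolation_eq_zero hx
  have h1 := (abs_le.mp (h x s (by simpa using hδ) hs)).1
  have h2 : 0 ≤ inner ℝ s (hess g x s) :=
    (mul_nonneg hlam (sq_nonneg _)).trans (lamMin_mul_norm_sq_le hg x s)
  rw [trModel, hgrad, inner_zero_right] at h1
  linarith

end Critical

theorem nonneg_of_forall_eventually_sub_le {φ : ℝ → ℝ} {φ' : ℝ} (hφ : HasDerivAt φ φ' 0)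
    (h : ∀ ε > 0, ∀ᶠ τ in 𝓝[>] (0 : ℝ), φ 0 - ε * τ ≤ φ τ) : 0 ≤ φ' := by
  refine le_of_forall_pos_le_add fun ε hε => ?_
  have ht : Tendsto (slope φ 0) (𝓝[>] 0) (𝓝 φ') :=
    (hasDerivAt_iff_tendsto_slope.mp hφ).mono_left
      (nhdsWithin_mono _ fun τ (hτ : 0 < τ) => hτ.ne')
  have : -ε ≤ φ' := by
    refine ge_of_tendsto ht ?_
    filter_upwards [h ε hε, self_mem_nhdsWithin] with τ h1 (h2 : 0 < τ)
    rw [slope_def_field, sub_zero, le_div_iff₀ h2]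
    linarith
  linarith

/-! ### From critical factors to stationary matrices. -/

section Stationary

variable {m n r : ℕ} {f : Matrix (Fin m) (Fin n) ℝ → ℝ} {z : FactorSpace m n r}

/-- At a second-order critical point of the lifted cost function, the cost function does not
decrease at first order along a direction reached by a curve of factors of speed `O(√τ)`. -/
theorem fderiv_nonneg_of_curve (hf : ContDiff ℝ 2 f)
    (hz : secondOrderViolation (fun z => f (lrLift z)) z = 0) {D : Matrix (Fin m) (Fin n) ℝ}
    {s : ℝ → FactorSpace m n r} {C : ℝ}
    (hs : ∀ τ, 0 < τ → τ < 1 → ‖s τ‖ ^ 2 ≤ C * τ ∧ lrLift (z + s τ) = lrLift z + τ • D) :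
    0 ≤ fderiv ℝ f (lrLift z) D := by
  have hC : 0 ≤ C := by
    have := (sq_nonneg _).trans (hs (1 / 2) (by norm_num) (by norm_num)).1
    linarith
  have hd : HasDerivAt (fun τ : ℝ => f (lrLift z + τ • D)) (fderiv ℝ f (lrLift z) D) 0 := by
    have h1 : HasDerivAt (fun τ : ℝ => lrLift z + τ • D) ((1 : ℝ) • D) 0 :=
      ((hasDerivAt_id (0 : ℝ)).smul_const D).const_add _
    have h2 : HasFDerivAt f (fderiv ℝ f (lrLift z)) (lrLift z + (0 : ℝ) • D) := by
      rw [zero_smul, add_zero]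
      exact (hf.differentiable (by norm_num) _).hasFDerivAt
    have h3 := h2.comp_hasDerivAt (0 : ℝ) h1
    rwa [one_smul] at h3
  refine nonneg_of_forall_eventually_sub_le hd fun ε hε => ?_
  -- A loss of ε‖s‖²/(C + 1) with ‖s‖² ≤ Cτ is at most ετ, which is why speed √τ is affordable.
  obtain ⟨δ, hδ, h⟩ := exists_ball_sub_le_of_secondOrderViolation_eq_zero
    (hf.comp contDiff_lrLift) hz (ε := ε / (C + 1)) (by positivity)
  have hlt : (0 : ℝ) < min 1 (δ ^ 2 / (C + 1)) := lt_min one_pos (by positivity)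
  filter_upwards [Ioo_mem_nhdsGT hlt] with τ hτ
  obtain ⟨h0, h1⟩ := hτ
  obtain ⟨h2, h3⟩ := hs τ h0 (h1.trans_le (min_le_left _ _))
  have h4 : ‖s τ‖ < δ := by
    refine lt_of_pow_lt_pow_left₀ 2 hδ.le (h2.trans_lt ?_)
    have h5 := (lt_div_iff₀ (by positivity)).mp (h1.trans_le (min_le_right _ _))
    linarith
  have h5 := h (s τ) h4
  have h6 : ε / (C + 1) * ‖s τ‖ ^ 2 ≤ ε * τ := by
    calc _ ≤ ε / (C + 1) * (C * τ) := by gcongr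
      _ ≤ ε / (C + 1) * ((C + 1) * τ) := by gcongr; linarith
      _ = ε * τ := by field_simp
  simp only [Function.comp_apply] at h5
  rw [h3] at h5
  rw [zero_smul, add_zero]
  linarith

/-- Moving one factor alone leaves no quadratic term in the lift; opposite directions give both
signs. -/
theorem fderiv_mul_transpose_eq_zero (hf : ContDiff ℝ 2 f)
    (hz : secondOrderViolation (fun z => f (lrLift z)) z = 0) :
    (∀ A : Matrix (Fin m) (Fin r) ℝ, fderiv ℝ f (lrLift z) (A * (rightFactor z)ᵀ) = 0) ∧
      ∀ B : Matrix (Fin n) (Fin r) ℝ, fderiv ℝ f (lrLift z) (leftFactor z * Bᵀ) = 0 := by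
  have key : ∀ s : FactorSpace m n r, leftFactor s * (rightFactor s)ᵀ = 0 →
      0 ≤ fderiv ℝ f (lrLift z)
        (leftFactor s * (rightFactor z)ᵀ + leftFactor z * (rightFactor s)ᵀ) := by
    intro s hs
    refine fderiv_nonneg_of_curve hf hz (s := fun τ => τ • s) (C := ‖s‖ ^ 2) fun τ h0 h1 => ⟨?_, ?_⟩
    · rw [norm_smul, Real.norm_of_nonneg h0.le, mul_pow, mul_comm]
      gcongr
      nlinarith
    · rw [lrLift_add_smul, hs, smul_zero, add_zero]
  constructor
  · intro A
    have h1 := key (factorPair A 0) (by simp)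
    have h2 := key (factorPair (-A) 0) (by simp)
    simp only [leftFactor_factorPair, rightFactor_factorPair, Matrix.transpose_zero,
      Matrix.mul_zero, add_zero, Matrix.neg_mul, map_neg] at h1 h2
    linarith
  · intro B
    have h1 := key (factorPair 0 B) (by simp)
    have h2 := key (factorPair 0 (-B)) (by simp)
    simp only [leftFactor_factorPair, rightFactor_factorPair, Matrix.transpose_neg,
      Matrix.zero_mul, zero_add, Matrix.mul_neg, map_neg] at h1 h2
    linarith

/-- The zero column kills the linear terms of the lift, so a √τ-curve supported in it moves the
product by exactly τ times a multiple of a matrix unit, of either sign. -/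
theorem fderiv_eq_zero_of_common_zero_column (hf : ContDiff ℝ 2 f)
    (hz : secondOrderViolation (fun z => f (lrLift z)) z = 0) {a : Fin r}
    (hL : ∀ i, leftFactor z i a = 0) (hR : ∀ j, rightFactor z j a = 0) :
    fderiv ℝ f (lrLift z) = 0 := by
  have key : ∀ i j (c : ℝ), 0 ≤ fderiv ℝ f (lrLift z) (Matrix.single i j c) := by
    intro i j c
    set s : FactorSpace m n r := factorPair (Matrix.single i a c) (Matrix.single j a 1) with hs
    have h1 : Matrix.single i a c * (rightFactor z)ᵀ = 0 := by
      ext i' j'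
      by_cases h : i = i' <;> simp [Matrix.mul_apply, Matrix.single_apply, hR, h]
    have h2 : leftFactor z * (Matrix.single j a (1 : ℝ))ᵀ = 0 := by
      ext i' j'
      by_cases h : j = j' <;> simp [Matrix.mul_apply, Matrix.single_apply, hL, h]
    refine fderiv_nonneg_of_curve hf hz (s := fun τ => √τ • s) (C := ‖s‖ ^ 2) fun τ h0 _ => ⟨?_, ?_⟩
    · rw [norm_smul, mul_pow, Real.norm_eq_abs, sq_abs, Real.sq_sqrt h0.le, mul_comm]
    · rw [lrLift_add_smul, Real.sq_sqrt h0.le, hs, leftFactor_factorPair, rightFactor_factorPair,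
        h1, h2]
      simp
  refine ContinuousLinearMap.ext fun D => ?_
  rw [Matrix.matrix_eq_sum_single D, map_sum, zero_apply]
  simp only [map_sum]
  refine Finset.sum_eq_zero fun i _ => Finset.sum_eq_zero fun j _ => ?_
  have h1 := key i j (D i j)
  have h2 := key i j (-D i j)
  have h3 : Matrix.single i j (-D i j) = -Matrix.single i j (D i j) :=
    map_neg (Matrix.singleAddMonoidHom i j) _
  rw [h3, map_neg] at h2
  linarith

/-- A linear form that vanishes on the tangent space at a matrix of rank `r`, given in factored
form, vanishes on the tangent cone of the variety of matrices of rank at most `r`. -/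
theorem apply_eq_zero_of_mem_posTangentConeAt {L : Matrix (Fin m) (Fin r) ℝ}
    {R : Matrix (Fin n) (Fin r) ℝ} (hL : (Lᵀ * L).det ≠ 0) (hR : (Rᵀ * R).det ≠ 0)
    {ℓ : Matrix (Fin m) (Fin n) ℝ →L[ℝ] ℝ} (h1 : ∀ A : Matrix (Fin m) (Fin r) ℝ, ℓ (A * Rᵀ) = 0)
    (h2 : ∀ B : Matrix (Fin n) (Fin r) ℝ, ℓ (L * Bᵀ) = 0) {D : Matrix (Fin m) (Fin n) ℝ}
    (hD : D ∈ posTangentConeAt (boundedRank m n r) (L * Rᵀ)) : ℓ D = 0 := by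
  obtain ⟨α, l, hl, c, d, hd, hmem, hcd⟩ := exists_fun_of_mem_tangentConeAt hD
  set A : α → Matrix (Fin r) (Fin r) ℝ := fun k => Lᵀ * (L * Rᵀ + d k) * R with hA
  have hA0 : (Lᵀ * (L * Rᵀ + 0) * R).det ≠ 0 := by
    have : Lᵀ * (L * Rᵀ + 0) * R = (Lᵀ * L) * (Rᵀ * R) := by
      rw [add_zero]; simp only [Matrix.mul_assoc]
    rw [this, Matrix.det_mul]
    exact mul_ne_zero hL hR
  have hAc : Continuous fun x : Matrix (Fin m) (Fin n) ℝ => Lᵀ * (L * Rᵀ + x) * R :=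
    (continuous_const.matrix_mul (continuous_const.add continuous_id)).matrix_mul continuous_const
  have hdet : Tendsto (fun k => (A k).det) l (𝓝 (Lᵀ * (L * Rᵀ + 0) * R).det) :=
    (hAc.matrix_det.tendsto 0).comp hd
  have hinv : Tendsto (fun k => (A k)⁻¹) l (𝓝 (Lᵀ * (L * Rᵀ + 0) * R)⁻¹) := by
    simp only [Matrix.inv_def, Ring.inverse_eq_inv']
    exact (hdet.inv₀ hA0).smul ((hAc.matrix_adjugate.tendsto 0).comp hd)
  -- Expanding the Schur identity at LRᵀ + d gives terms of the forms L(·) and (·)Rᵀ, killed by ℓ,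
  -- plus a remainder with two factors d. Scaled by c, one factor tends to D and the other to 0.
  have hexp : ∀ᶠ k in l, ℓ (c k • d k) = ℓ ((c k • d k) * R * (A k)⁻¹ * (Lᵀ * d k)) := by
    filter_upwards [hmem, hdet.eventually_ne hA0] with k hk hk'
    have h3 := Matrix.mul_inv_compression_mul_eq hk L R hk'
    have h4 : (L * Rᵀ + d k) * R * (A k)⁻¹ * (Lᵀ * (L * Rᵀ + d k)) =
        L * (((Rᵀ * R * (A k)⁻¹ * (Lᵀ * (L * Rᵀ + d k)))ᵀ)ᵀ) +
          (d k * R * (A k)⁻¹ * (Lᵀ * L)) * Rᵀ + d k * R * (A k)⁻¹ * (Lᵀ * d k) := by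
      rw [Matrix.transpose_transpose]
      simp only [Matrix.add_mul, Matrix.mul_add, Matrix.mul_assoc]
      abel
    have h5 : ℓ (d k) = ℓ (d k * R * (A k)⁻¹ * (Lᵀ * d k)) := by
      have h6 := congrArg ℓ (h4.symm.trans h3)
      rw [map_add, map_add, map_add, h1, h1, h2] at h6
      linarith
    have h7 : (c k • d k) * R * (A k)⁻¹ * (Lᵀ * d k) =
        (c k : ℝ) • (d k * R * (A k)⁻¹ * (Lᵀ * d k)) := by
      rw [NNReal.smul_def]
      simp only [Matrix.smul_mul]
    rw [h7, NNReal.smul_def, map_smul, map_smul, h5]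
  have hmul : Continuous fun q : Matrix (Fin m) (Fin n) ℝ × Matrix (Fin r) (Fin r) ℝ ×
      Matrix (Fin m) (Fin n) ℝ => ℓ (q.1 * R * q.2.1 * (Lᵀ * q.2.2)) :=
    ℓ.continuous.comp (((continuous_fst.matrix_mul continuous_const).matrix_mul
      continuous_snd.fst).matrix_mul (continuous_const.matrix_mul continuous_snd.snd))
  have hlim := (hmul.tendsto (D, (Lᵀ * (L * Rᵀ + 0) * R)⁻¹, 0)).comp
    (hcd.prodMk_nhds (hinv.prodMk_nhds hd))
  have hlim' : Tendsto (fun k => ℓ (c k • d k)) l (𝓝 (ℓ D)) := (ℓ.continuous.tendsto D).comp hcd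
  have := tendsto_nhds_unique hlim' (hlim.congr' (hexp.mono fun k hk => hk.symm))
  simpa using this

/-- Balanced second-order critical points of the lifted cost function are mapped to stationary
points. -/
theorem IsBalanced.isRankStationary (hz : IsBalanced z) (hf : ContDiff ℝ 2 f)
    (hcrit : secondOrderViolation (fun z => f (lrLift z)) z = 0) :
    IsRankStationary r f (lrLift z) := by
  refine ⟨rank_lrLift_le z, fun D hD => ?_⟩
  set G := (leftFactor z)ᵀ * leftFactor z with hG
  have hGd : G = Matrix.diagonal G.diag := hz.1
  by_cases h : ∃ a, G a a = 0
  · obtain ⟨a, ha⟩ := h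
    have hcol : ∀ {k : ℕ} (M : Matrix (Fin k) (Fin r) ℝ), (Mᵀ * M) a a = 0 → ∀ i, M i a = 0 := by
      intro k M hM i
      rw [Matrix.mul_apply] at hM
      have := (Finset.sum_eq_zero_iff_of_nonneg (fun i _ => mul_self_nonneg (M i a))).mp hM i
        (Finset.mem_univ i)
      exact mul_self_eq_zero.mp this
    rw [fderiv_eq_zero_of_common_zero_column hf hcrit (hcol _ ha)
      (hcol _ (by rw [hz.2]; exact ha))]
    simp
  · push Not at h
    have hdet : G.det ≠ 0 := by
      rw [hGd, Matrix.det_diagonal]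
      exact Finset.prod_ne_zero_iff.mpr fun a _ => h a
    obtain ⟨h1, h2⟩ := fderiv_mul_transpose_eq_zero hf hcrit
    exact (apply_eq_zero_of_mem_posTangentConeAt hdet (by rw [hz.2]; exact hdet) h1 h2 hD).ge

end Stationary

/-! ### Runs of the low-rank method. -/

section Runs

variable {m n r : ℕ} {p : TRParams} {Φ : FactorSpace m n r → FactorSpace m n r}
  {f : Matrix (Fin m) (Fin n) ℝ → ℝ} {yin : FactorSpace m n r} {y : ℕ → FactorSpace m n r}
  {γ : ℕ → ℝ}

theorem IsTRRun.antitone_lrLift (hΦ : IsSVDRebalancing Φ)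
    (h : IsTRRun p Φ (fun z => f (lrLift z)) yin y γ) : Antitone fun k => f (lrLift (y k)) :=
  IsTRRun.antitone (g := fun z => f (lrLift z)) (fun z => congrArg f (hΦ.lrLift_apply z)) h

theorem IsTRRun.exists_forall_mem_closedBall (hΦ : IsSVDRebalancing Φ)
    (h : IsTRRun p Φ (fun z => f (lrLift z)) yin y γ)
    (hb : Bornology.IsBounded {X | X ∈ boundedRank m n r ∧ f X ≤ f (lrLift yin)}) :
    ∃ ρ, ∀ k, y k ∈ Metric.closedBall 0 ρ := by
  obtain ⟨C, hC⟩ := hb.exists_norm_le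
  refine ⟨√(2 * r * C), fun k => ?_⟩
  have hanti := h.antitone_lrLift hΦ
  have hk : f (lrLift (y k)) ≤ f (lrLift yin) := by
    have := hanti (Nat.zero_le k)
    simpa only [h.1, hΦ.lrLift_apply] using this
  have hbal : IsBalanced (y k) := by
    obtain ⟨w, hw⟩ := h.mem_range k
    exact hw ▸ hΦ.isBalanced w
  rw [mem_closedBall_zero_iff]
  refine Real.le_sqrt_of_sq_le (hbal.norm_sq_le.trans ?_)
  gcongr
  exact hC _ ⟨rank_lrLift_le _, hk⟩

theorem IsTRRun.isRankStationary (hΦ : IsSVDRebalancing Φ) (hf : ContDiff ℝ 2 f)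
    (h : IsTRRun p Φ (fun z => f (lrLift z)) yin y γ)
    (hb : Bornology.IsBounded {X | X ∈ boundedRank m n r ∧ f X ≤ f (lrLift yin)})
    {X : Matrix (Fin m) (Fin n) ℝ} (hX : MapClusterPt X atTop fun k => lrLift (y k)) :
    IsRankStationary r f X := by
  obtain ⟨ρ, hρ⟩ := h.exists_forall_mem_closedBall hΦ hb
  -- Along an ultrafilter, compactness makes the factors converge too, so X lifts to an accumulation
  -- point of the factors.
  obtain ⟨u, hu, hXu⟩ := mapClusterPt_iff_ultrafilter.mp hX
  obtain ⟨x, -, hx⟩ := (isCompact_closedBall (0 : FactorSpace m n r) ρ).ultrafilter_le_nhds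
    (u.map y) (by
      rw [le_principal_iff]
      exact Filter.mem_map.mpr (Filter.univ_mem' hρ))
  have hyx : Tendsto y u (𝓝 x) := hx
  have hlift : Tendsto (fun k => lrLift (y k)) u (𝓝 (lrLift x)) :=
    ((contDiff_lrLift (k := 0)).continuous.tendsto x).comp hyx
  obtain rfl : X = lrLift x := tendsto_nhds_unique hXu hlift
  have hbal : IsBalanced x := isClosed_isBalanced.mem_of_tendsto hyx
    (Eventually.of_forall fun k => by
      obtain ⟨w, hw⟩ := h.mem_range k
      rw [← hw]
      exact hΦ.isBalanced w)
  exact hbal.isRankStationary hf <| IsTRRun.secondOrderViolation_eq_zero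
    (hf.comp contDiff_lrLift) (fun z => congrArg f (hΦ.lrLift_apply z)) h
    (mapClusterPt_iff_ultrafilter.mpr ⟨u, hu, hyx⟩)

end Runs

end

theorem theorem1 (m n r : ℕ) (p : TRParams) :
    (∃ Φ : FactorSpace m n r → FactorSpace m n r, IsSVDRebalancing Φ) ∧
    ∀ Φ : FactorSpace m n r → FactorSpace m n r, IsSVDRebalancing Φ →
    ∀ f : Matrix (Fin m) (Fin n) ℝ → ℝ, ContDiff ℝ 3 f →
      -- each iteration can be carried out
      (∀ (y : FactorSpace m n r) (γ : ℝ), 0 < γ →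
        ∃ y' γ', TRStep p Φ (fun z => f (lrLift z)) y γ y' γ') ∧
      ∀ X₀ ∈ boundedRank m n r,
        Bornology.IsBounded {X | X ∈ boundedRank m n r ∧ f X ≤ f X₀} →
        -- the method generates a sequence from `X₀`
        (∃ y γ, IsLowRankRun p Φ f X₀ y γ) ∧
        -- every sequence that it may generate from `X₀` has the claimed properties
        ∀ (y : ℕ → FactorSpace m n r) (γ : ℕ → ℝ), IsLowRankRun p Φ f X₀ y γ →
          lrLift (y 0) = X₀ ∧
          (∀ k, lrLift (y k) ∈ boundedRank m n r) ∧
          Antitone (fun k => f (lrLift (y k))) ∧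
          (∃ X, MapClusterPt X atTop (fun k => lrLift (y k))) ∧
          ∀ X, MapClusterPt X atTop (fun k => lrLift (y k)) → IsRankStationary r f X := by
  refine ⟨exists_isSVDRebalancing m n r, fun Φ hΦ f hf3 => ?_⟩
  have hf : ContDiff ℝ 2 f := hf3.of_le (by norm_num)
  have hg : ContDiff ℝ 2 fun z : FactorSpace m n r => f (lrLift z) := hf.comp contDiff_lrLift
  refine ⟨fun y γ hγ => exists_trStep p Φ hg y hγ.le, fun X₀ hX₀ hb => ⟨?_, ?_⟩⟩
  · obtain ⟨yin, hyin⟩ := exists_lrLift_eq hX₀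
    obtain ⟨y, γ, h⟩ := exists_isTRRun p Φ hg yin
    exact ⟨y, γ, yin, hyin, h⟩
  · rintro y γ ⟨yin, rfl, h⟩
    refine ⟨by rw [h.1, hΦ.lrLift_apply], fun k => rank_lrLift_le _,
      h.antitone_lrLift hΦ, ?_, fun X hX => h.isRankStationary hΦ hf hb hX⟩
    obtain ⟨ρ, hρ⟩ := h.exists_forall_mem_closedBall hΦ hb
    obtain ⟨x, -, hx⟩ := (isCompact_closedBall (0 : FactorSpace m n r) ρ).exists_mapClusterPt
      (f := atTop) (u := y) (by
        rw [le_principal_iff]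
        exact Filter.mem_map.mpr (Filter.univ_mem' hρ))
    exact ⟨lrLift x, hx.continuousAt_comp (contDiff_lrLift (k := 0)).continuous.continuousAt⟩
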